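/- **Setting.** Let $\mathcal C=\mathcal V\times\mathcal X$ be a set of covariates $\mathbf c=(\mathbf v,\mathbf x)$ ($\mathbf v$ cluster-level, $\mathbf x$ individual-level), let $S\subseteq\mathbb R^q$ with Borel $\sigma$-algebra $\mathcal B$, let $\mathcal P(S)$ be the set of Borel probability measures on $S$, let $G^0_{\mathbf c}\in\mathcal P(S)$ for $\mathbf c\in\mathcal C$, let $\alpha,\beta>0$, and let $K^*(\mathbf v;\Gamma)\in(0,1]$ be a kernel, measurable in $\Gamma$. Let $\Psi$ be a collection of copulas, one for every finite set of indices in $\mathcal C\times\{1,\dots,q\}$, that is consistent under setting arguments equal to $1$. A *fully dependent nested dependent Dirichlet process* (FD-nDDP) on a probability space $(\Omega,\mathcal F,P)$ consists of mutually independent objects: random variables $s^*_k\sim\mathrm{Beta}(1,\alpha)$ and $u^*_{lk}\sim\mathrm{Beta}(1,\beta)$ with values in $[0,1]$, $S$-valued processes $\theta^*_{lk}=\{\theta^*_{lk}(\mathbf c):\mathbf c\in\mathcal C\}$ ($l,k\ge 1$) and a sequence of kernel locations $\Gamma=(\Gamma_k)_{k\ge1}$ (deterministic, or random with any law), where $\theta^*_{lk}(\mathbf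 c)\sim G^0_{\mathbf c}$ and the joint distribution function of finitely many real coordinates $\theta^*_{lk}(\mathbf c)_m$ is the corresponding copula in $\Psi$ applied to their marginal distribution functions; together with $\mathcal P(S)$-valued processes $F^*_{\mathbf c,k}$ and $F(\mathbf c,\cdot)$ such that, for all $\mathbf c$ and $B\in\mathcal B$, almost surely $$F^*_{\mathbf c,k}(B)=\sum_{l\ge1}w^*_{lk}\,\delta_{\theta^*_{lk}(\mathbf c)}(B),\qquad F(\mathbf c,\cdot)(B)=\sum_{k\ge1}\pi^*_k(\mathbf v)F^*_{\mathbf c,k}(B),$$ $$w^*_{lk}=u^*_{lk}\prod_{i<l}(1-u^*_{ik}),\qquad \pi^*_k(\mathbf v)=K^*(\mathbf v;\Gamma_k)s^*_k\prod_{m<k}\bigl(1-K^*(\mathbf v;\Gamma_m)s^*_m\bigr).$$ (In particular $\sum_k\pi^*_k(\mathbf v)=1$ almost surely, for every $\mathbf v$ that occurs in a $\mathbf c \in \mathcal C$.) The random measures of the clusters $i=1,\dots,I$ are $F_{\mathbf c,i}\sim\sum_k\pi^*_k(\mathbf v)\delta_{F^*_{\mathbf c,k}}$, that is, $F_{\mathbf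 c,i}=F^*_{\mathbf c,\zeta_i(\mathbf v)}$ with class indicators $\zeta_i(\mathbf v)$ satisfying $P(\zeta_i(\mathbf v)=k\mid s^*,u^*,\theta^*,\Gamma)=\pi^*_k(\mathbf v)$ and conditionally independent for different clusters: for every choice of one covariate value $\mathbf v_i$ for each cluster $i$, the variables $\zeta_1(\mathbf v_1),\dots,\zeta_I(\mathbf v_I)$ are conditionally independent given $s^*,u^*,\theta^*,\Gamma$. **Proposition.** 1. For all $i$, $\mathbf c$ and $A\in\mathcal B$, $F_{\mathbf c,i}(A)$ is square integrable, $$\mathbb E[F_{\mathbf c,i}(A)]=G^0_{\mathbf c}(A),\qquad \mathbb V[F_{\mathbf c,i}(A)]=\frac{G^0_{\mathbf c}(A)\,(1-G^0_{\mathbf c}(A))}{\beta+1}.$$ 2. For $\mathbf c=(\mathbf v,\mathbf x)$, $\mathbf c'=(\mathbf v',\mathbf x')$ in $\mathcal C$ and $A,B\in\mathcal B$ with $G^0_{\mathbf c}(A),G^0_{\mathbf c'}(B)\in(0,1)$, put $\rho_{\mathbf c,\mathbf c'}(A,B)=P\{\theta^*_{lk}(\mathbf c)\in A,\ \theta^*_{lk}(\mathbf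 c')\in B\}$ (for any $l,k$) and $$R=\frac{\rho_{\mathbf c,\mathbf c'}(A,B)-G^0_{\mathbf c}(A)G^0_{\mathbf c'}(B)}{\sqrt{G^0_{\mathbf c}(A)(1-G^0_{\mathbf c}(A))\,G^0_{\mathbf c'}(B)(1-G^0_{\mathbf c'}(B))}}.$$ Within one cluster, where $\mathbf v=\mathbf v'$, $\operatorname{Corr}(F_{\mathbf c,i}(A),F_{\mathbf c',i}(B))=R$. For $i\ne j$ and arbitrary $\mathbf v,\mathbf v'$, $$\operatorname{Corr}(F_{\mathbf c,i}(A),F_{\mathbf c',j}(B))=\mathbb E\bigl[h(\alpha,\mathbf v,\mathbf v';\Gamma)\bigr]\,R ,$$ where the expectation is over the law of $\Gamma$ and $$h(\alpha,\mathbf v,\mathbf v';\Gamma)=\frac{2}{(\alpha+1)(\alpha+2)}\sum_{k=1}^\infty K^*(\mathbf v;\Gamma_k)K^*(\mathbf v';\Gamma_k)\prod_{j=1}^{k-1}\Bigl\{1-\frac{K^*(\mathbf v;\Gamma_j)+K^*(\mathbf v';\Gamma_j)}{\alpha+1}+\frac{2K^*(\mathbf v;\Gamma_j)K^*(\mathbf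 v';\Gamma_j)}{(\alpha+1)(\alpha+2)}\Bigr\},$$ a series that converges for every sequence of locations. In particular, if $\Gamma$ is deterministic, the correlation is $h(\alpha,\mathbf v,\mathbf v';\Gamma)\,R$. 3. Suppose that every copula in $\Psi$ has an (almost everywhere) positive density with respect to Lebesgue measure on the unit cube of the appropriate dimension, and that the $G^0_{\mathbf c}$, $\mathbf c\in\mathcal C$, have a common topological support $\Theta\subseteq S$. Then $\mathcal P(\Theta)^{\mathcal C}=\{Q\in\mathcal P(S)^{\mathcal C}: Q_{\mathbf c}(\Theta)=1\ \forall\mathbf c\}$ is the weak support of the process $\{F(\mathbf c,\cdot):\mathbf c\in\mathcal C\}$, and also of $\{F_{\mathbf c,i}:\mathbf c\in\mathcal C\}$ for each $i$. Here the weak support is the intersection of all closed subsets of $\mathcal P(S)^{\mathcal C}$ (product topology of weak convergence) to which the process belongs almost surely. Moreover, for each countable $\mathcal C_0\subseteq\mathcal C$, the process is almost surely concentrated on $\Theta$ at all $\mathbf c\in\mathcal C_0$; so for countable $\mathcal C$ the set $\mathcal P(\Theta)^{\mathcal C}$ is the smallest closed set of probability one. -/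

import Mathlib

open MeasureTheory ProbabilityTheory Filter
open scoped Topology ENNReal unitInterval

noncomputable section

/-- A copula on a finite set `ι` of coordinates, given by its law: a probability measure on the
cube `[0,1]^ι` all of whose one-dimensional marginals are uniform. -/
structure Copula (ι : Type*) [Fintype ι] where
  law : ProbabilityMeasure (ι → I)
  uniform : ∀ i, (law : Measure (ι → I)).map (fun u => u i) = volume

/-- The copula as a function `ψ(u) = P(U_i ≤ u_i for all i)`. -/
def Copula.toFun {ι : Type*} [Fintype ι] (ψ : Copula ι) (u : ι → I) : ℝ :=
  (ψ.law : Measure (ι → I)).real (Set.Iic u)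

/-- The copula has a density with respect to Lebesgue measure on `[0,1]^ι` that is positive
almost everywhere. -/
def Copula.HasPositiveDensity {ι : Type*} [Fintype ι] (ψ : Copula ι) : Prop :=
  ∃ f : (ι → I) → ℝ≥0∞, Measurable f ∧ (∀ᵐ u, 0 < f u) ∧
    (ψ.law : Measure (ι → I)) = volume.withDensity f

/-- A consistent collection of copulas over an index set `T`: one copula for every finite set of
indices (so that there is no dependence on an ordering of the indices), such that setting
coordinates of a copula equal to `1` gives the copula of the remaining indices. -/
structure CopulaFamily (T : Type*) where
  copula : (s : Finset T) → Copula s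
  consistent : ∀ (s t : Finset T) (h : t ⊆ s) (u : s → I), (∀ p : s, p.1 ∉ t → u p = 1) →
    (copula s).toFun u = (copula t).toFun (fun p => u ⟨p.1, h p.2⟩)

/-- The distribution function of the `m`-th coordinate under a probability measure on
`S ⊆ ℝ^q`. -/
def coordCdf {q : ℕ} {S : Set (Fin q → ℝ)} (G : ProbabilityMeasure S) (m : Fin q) (t : ℝ) : I :=
  ⟨(G : Measure S).real {x | x.1 m ≤ t}, measureReal_nonneg, measureReal_le_one⟩

/-- The stick-breaking weights `b_k ∏_{i<k} (1 - b_i)` (indices start at `0`). -/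
def stickBreak (b : ℕ → ℝ) (k : ℕ) : ℝ :=
  b k * ∏ i ∈ Finset.range k, (1 - b i)

/-- The fully dependent nested dependent Dirichlet process over the covariate set `V × X`,
on a probability space `(Ω, P)`. Here `s` are the cluster-level sticks, `u l k` the inner sticks,
`θ l k` the atom processes and `Γ k` the (deterministic or random) kernel locations. -/
structure FDnDDP {Ω : Type*} [MeasurableSpace Ω] (P : Measure Ω) {V X Loc : Type*}
    [MeasurableSpace Loc] {q : ℕ} {S : Set (Fin q → ℝ)} (α β : ℝ) (K : V → Loc → ℝ)
    (Ψ : CopulaFamily ((V × X) × Fin q)) (G : V × X → ProbabilityMeasure S) where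
  s : ℕ → Ω → ℝ
  u : ℕ → ℕ → Ω → ℝ
  θ : ℕ → ℕ → V × X → Ω → S
  Γ : ℕ → Ω → Loc
  /-- the inner random measures `F*_k(c, ω)` -/
  Fstar : ℕ → V × X → Ω → ProbabilityMeasure S
  /-- the mixture `F(c, ω)` -/
  F : V × X → Ω → ProbabilityMeasure S
  measurable_s : ∀ k, Measurable (s k)
  measurable_u : ∀ l k, Measurable (u l k)
  measurable_θ : ∀ l k c, Measurable (θ l k c)
  measurable_Γ : ∀ k, Measurable (Γ k)
  s_mem : ∀ k ω, s k ω ∈ Set.Icc (0 : ℝ) 1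
  u_mem : ∀ l k ω, u l k ω ∈ Set.Icc (0 : ℝ) 1
  law_s : ∀ k, P.map (s k) = betaMeasure 1 α
  law_u : ∀ l k, P.map (u l k) = betaMeasure 1 β
  /-- the marginal distributions of the atoms are the `G c` -/
  law_θ : ∀ l k c, P.map (θ l k c) = (G c : Measure S)
  /-- the finite dimensional distributions of the atoms (of all their real coordinates) are given
  by the copulas and the marginals -/
  fdd_θ : ∀ l k (J : Finset ((V × X) × Fin q)) (t : J → ℝ),
    P.real {ω | ∀ p : J, (θ l k p.1.1 ω).1 p.1.2 ≤ t p} =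
      (Ψ.copula J).toFun (fun p => coordCdf (G p.1.1) p.1.2 (t p))
  /-- all sticks, all atom processes and the sequence of locations are mutually independent -/
  indep : iIndep (fun a : ℕ ⊕ (ℕ × ℕ) ⊕ (ℕ × ℕ) ⊕ Unit =>
    match a with
    | .inl k => MeasurableSpace.comap (s k) inferInstance
    | .inr (.inl p) => MeasurableSpace.comap (u p.1 p.2) inferInstance
    | .inr (.inr (.inl p)) =>
        MeasurableSpace.comap (fun ω (c : V × X) => θ p.1 p.2 c ω) inferInstance
    | .inr (.inr (.inr _)) =>
        MeasurableSpace.comap (fun ω (k : ℕ) => Γ k ω) inferInstance) P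
  Fstar_eq : ∀ k c (B : Set S), MeasurableSet B → ∀ᵐ ω ∂P,
    (Fstar k c ω : Measure S) B =
      ∑' l, ENNReal.ofReal (stickBreak (fun i => u i k ω) l) * Measure.dirac (θ l k c ω) B
  /-- As `F c ω` is a probability measure, the weights sum to one almost surely. -/
  F_eq : ∀ c (B : Set S), MeasurableSet B → ∀ᵐ ω ∂P,
    (F c ω : Measure S) B =
      ∑' k, ENNReal.ofReal (stickBreak (fun i => K c.1 (Γ i ω) * s i ω) k) *
        (Fstar k c ω : Measure S) B

namespace FDnDDP

variable {Ω : Type*} [MeasurableSpace Ω] {P : Measure Ω} {V X Loc : Type*}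
  [MeasurableSpace Loc] {q : ℕ} {S : Set (Fin q → ℝ)} {α β : ℝ} {K : V → Loc → ℝ}
  {Ψ : CopulaFamily ((V × X) × Fin q)} {G : V × X → ProbabilityMeasure S}

/-- The kernel stick-breaking cluster weight `π_k(v)`, with sticks `U_k(v) = K(v; Γ_k) s_k`. -/
def clusterWeight (H : FDnDDP P α β K Ψ G) (k : ℕ) (v : V) (ω : Ω) : ℝ :=
  stickBreak (fun i => K v (H.Γ i ω) * H.s i ω) k

/-- The σ-algebra generated by all sticks, atoms and locations. -/
@[reducible] def sigma (H : FDnDDP P α β K Ψ G) : MeasurableSpace Ω :=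
  (⨆ k, MeasurableSpace.comap (H.s k) inferInstance) ⊔
  (⨆ l, ⨆ k, MeasurableSpace.comap (H.u l k) inferInstance) ⊔
  (⨆ l, ⨆ k, ⨆ c, MeasurableSpace.comap (H.θ l k c) inferInstance) ⊔
  (⨆ k, MeasurableSpace.comap (H.Γ k) inferInstance)

/-- Latent class indicators `ζ i v` of `n` clusters: given all sticks, atoms and locations,
cluster `i` with cluster-level covariate `v` is assigned to class `k` with probability `π_k(v)`,
independently across different clusters. -/
structure Allocation (H : FDnDDP P α β K Ψ G) (n : ℕ) where
  ζ : Fin n → V → Ω → ℕ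
  measurable_ζ : ∀ i v, Measurable (ζ i v)
  condLaw : ∀ (T : Finset (Fin n)) (v : Fin n → V) (k : Fin n → ℕ),
    P[Set.indicator {ω | ∀ i ∈ T, ζ i (v i) ω = k i} (fun _ => (1 : ℝ)) | H.sigma] =ᵐ[P]
      fun ω => ∏ i ∈ T, H.clusterWeight (k i) (v i) ω

/-- The random measure `F_{c,i} = F*_{c, ζ_i(v)}`, `c = (v, x)`, of cluster `i`; given the
sticks, atoms and locations it is a draw from `Q_c = ∑ₖ π_k(v) δ_{F*_{c,k}}`. -/
def Allocation.clusterF {H : FDnDDP P α β K Ψ G} {n : ℕ} (Z : H.Allocation n) (i : Fin n)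
    (c : V × X) (ω : Ω) : ProbabilityMeasure S :=
  H.Fstar (Z.ζ i c.1 ω) c ω

end FDnDDP

/-- The correlation coefficient of two real random variables. -/
def corr {Ω : Type*} [MeasurableSpace Ω] (Y Z : Ω → ℝ) (P : Measure Ω) : ℝ :=
  cov[Y, Z; P] / √(Var[Y; P] * Var[Z; P])

/-- The `k`-th term of the series in `hFactor` (indices start at `0`). -/
def hTerm {V Loc : Type*} (α : ℝ) (K : V → Loc → ℝ) (v v' : V) (γ : ℕ → Loc) (k : ℕ) : ℝ :=
  K v (γ k) * K v' (γ k) * ∏ j ∈ Finset.range k,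
    (1 - (K v (γ j) + K v' (γ j)) / (α + 1)
      + 2 * K v (γ j) * K v' (γ j) / ((α + 1) * (α + 2)))

/-- The factor `h(α, v, v')` for the kernel `K` with locations `γ`. -/
def hFactor {V Loc : Type*} (α : ℝ) (K : V → Loc → ℝ) (v v' : V) (γ : ℕ → Loc) : ℝ :=
  2 / ((α + 1) * (α + 2)) * ∑' k, hTerm α K v v' γ k

/-- The between-covariate correlation of the single-weights process: `ρ` is the probability
`P(θ(c) ∈ A, θ(c') ∈ B)`, and `a`, `b` stand for `G_c(A)`, `G_{c'}(B)`. -/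
def corrRatio (ρ a b : ℝ) : ℝ :=
  (ρ - a * b) / √(a * (1 - a) * b * (1 - b))

/-- The weak support of a process of random probability measures on `S` indexed by `C`: the
intersection of all closed sets which the process belongs to almost surely, in the product
(over `C`) of the topologies of weak convergence. -/
def weakSupport {Ω : Type*} [MeasurableSpace Ω] (P : Measure Ω) {C E : Type*}
    [TopologicalSpace E] [MeasurableSpace E] [OpensMeasurableSpace E]
    (F : C → Ω → ProbabilityMeasure E) : Set (C → ProbabilityMeasure E) :=
  ⋂₀ {D | IsClosed D ∧ ∀ᵐ ω ∂P, (fun c => F c ω) ∈ D}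

/-- The set `𝒫(Θ)^C`, as the set of all families of probability measures on `E` that are
concentrated on `Θ ⊆ E`. -/
def concentratedOn {E : Type*} [MeasurableSpace E] (C : Type*) (Θ : Set E) :
    Set (C → ProbabilityMeasure E) :=
  {Q | ∀ c, (Q c : Measure E) Θ = 1}

/-- `𝒫(Θ)^C` is the weak support of the process `F`, and `F` is concentrated on it with
probability one, along every countable set of indices (all of `C` if `C` is countable). -/
def HasFullWeakSupport {Ω : Type*} [MeasurableSpace Ω] (P : Measure Ω) {C E : Type*}
    [TopologicalSpace E] [MeasurableSpace E] [OpensMeasurableSpace E]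
    (F : C → Ω → ProbabilityMeasure E) (Θ : Set E) : Prop :=
  weakSupport P F = concentratedOn C Θ ∧
    ∀ C₀ : Set C, C₀.Countable → ∀ᵐ ω ∂P, ∀ c ∈ C₀, (F c ω : Measure E) Θ = 1

end

/-!
**Moments.** The number `F_{c,i}(A)` is the mass `F*_{c,ζ}(A)` given to `A` by the inner random
measure of the class `ζ` of the cluster. By the conditional law of the classes, expectations of
functions of the classes become sums over classes weighted by the cluster weights
(`Allocation.lintegral_class`, `Allocation.lintegral_class_class`), and the weights are functions
of sources that are independent of the inner measures. So only second moments of two kinds of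
stick-breaking weights are needed, and both come from `integral_stickBreak_mul_stickBreak`: the
sticks are integrated out one after the other, in the order of their indices, and every factor
`(1 - a X) (1 - b X)` is replaced by `1 - (a + b) m₁ + a b m₂`. For the inner weights this gives
`∑ E[w²] = 1 / (β + 1)`. For the cluster weights the locations stay inside the expectation, and the
probability of a common class is `E[h]`. Two independent draws from random
probability weights which coincide with probability `D` turn "value `r` if equal, `t` otherwise" into `D r + (1 - D) t`;
`ENNReal.tsum_tsum_mul_ite_add` is this identity without subtraction. It is used for the atoms of
one inner measure, with `D = 1 / (β + 1)`, and for the classes of two clusters, with `D = E[h]`.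
All sums are handled in `ℝ≥0∞`, so that no summability has to be checked on the way.

**Support.** All random measures are almost surely concentrated on the closed set `Θ`, because
their mean measures are. Conversely, a closed set that misses a family `Q` concentrated on `Θ` is
separated from `Q` by finitely many integrals of bounded continuous functions. The vector of these
integrals under `Q` lies in the closed convex hull of the vectors of values at points of `Θ^C`, so
it is approximated by a stick-breaking mixture of point masses in which the weights do not depend
on the covariate (`exists_stickBreak_approx`). The approximation persists for sticks and atoms in
open sets. These have positive probability: beta distributions charge all nonempty open subsets of
`[0, 1]`, and if the copulas have positive densities, the atoms of finitely many covariates charge all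
products of open sets that meet `Θ` (`FDnDDP.measure_θ_mem_pos`, where boxes are compared by
inclusion and exclusion). Hence the first `N` inner measures are simultaneously close to `Q` on an
event of positive probability. This event is independent of the cluster weights, and for large `N`
the expected weight of the remaining classes is small, so with positive probability the mixtures
`F(c, ·)`, and the measures of the clusters, are close to `Q` as well.
-/

/-! ### Stick-breaking weights -/

lemma one_sub_sum_stickBreak (b : ℕ → ℝ) (n : ℕ) :
    1 - ∑ k ∈ Finset.range n, stickBreak b k = ∏ i ∈ Finset.range n, (1 - b i) := by
  induction n with
  | zero => simp
  | succ n ih =>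
    rw [Finset.sum_range_succ, Finset.prod_range_succ, ← sub_sub, ih, stickBreak]
    ring

lemma stickBreak_nonneg {b : ℕ → ℝ} (hb : ∀ i, b i ∈ Set.Icc (0 : ℝ) 1) (k : ℕ) :
    0 ≤ stickBreak b k :=
  mul_nonneg (hb k).1 (Finset.prod_nonneg fun i _ => sub_nonneg.2 (hb i).2)

lemma stickBreak_le_one {b : ℕ → ℝ} (hb : ∀ i, b i ∈ Set.Icc (0 : ℝ) 1) (k : ℕ) :
    stickBreak b k ≤ 1 :=
  mul_le_one₀ (hb k).2 (Finset.prod_nonneg fun i _ => sub_nonneg.2 (hb i).2)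
    (Finset.prod_le_one (fun i _ => sub_nonneg.2 (hb i).2) fun i _ => by linarith [(hb i).1])

/-- Every probability vector arises by stick-breaking. The division by zero that occurs once the
stick is used up is harmless, as all remaining weights vanish. -/
lemma exists_stickBreak_eq {p : ℕ → ℝ} {N : ℕ} (hp : ∀ l, 0 ≤ p l)
    (hN : ∀ l, N ≤ l → p l = 0) (hsum : ∑ l ∈ Finset.range N, p l = 1) :
    ∃ b : ℕ → ℝ, (∀ i, b i ∈ Set.Icc (0 : ℝ) 1) ∧ (∀ l, stickBreak b l = p l) ∧
      ∏ i ∈ Finset.range N, (1 - b i) = 0 := by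
  set b : ℕ → ℝ := fun l => p l / (1 - ∑ i ∈ Finset.range l, p i) with hb
  have hle : ∀ l, ∑ i ∈ Finset.range l, p i ≤ 1 := by
    intro l
    rcases le_total l N with hl | hl
    · exact hsum ▸ Finset.sum_le_sum_of_subset_of_nonneg (Finset.range_mono hl) fun i _ _ => hp i
    · rw [← hsum, Finset.sum_subset (Finset.range_mono hl) fun i _ hi =>
        hN i (by simpa using hi)]
  have hz : ∀ l, 1 - ∑ i ∈ Finset.range l, p i = 0 → p l = 0 := by
    intro l h0
    have := hle (l + 1)
    rw [Finset.sum_range_succ] at this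
    linarith [hp l]
  have hprod : ∀ l, ∏ i ∈ Finset.range l, (1 - b i) = 1 - ∑ i ∈ Finset.range l, p i := by
    intro l
    induction l with
    | zero => simp
    | succ l ih =>
      rw [Finset.prod_range_succ, ih, Finset.sum_range_succ]
      by_cases h0 : 1 - ∑ i ∈ Finset.range l, p i = 0
      · rw [h0, zero_mul]; linarith [hz l h0]
      · simp only [hb]; field_simp; ring
  refine ⟨b, fun i => ⟨?_, ?_⟩, fun l => ?_, ?_⟩
  · exact div_nonneg (hp i) (sub_nonneg.2 (hle i))
  · refine div_le_one_of_le₀ ?_ (sub_nonneg.2 (hle i))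
    have := hle (i + 1)
    rw [Finset.sum_range_succ] at this
    linarith
  · rw [stickBreak, hprod l]
    by_cases h0 : 1 - ∑ i ∈ Finset.range l, p i = 0
    · rw [h0, mul_zero, hz l h0]
    · simp only [hb]; field_simp
  · rw [hprod N, hsum, sub_self]

/-! ### The beta distribution -/

lemma lintegral_pow_betaMeasure {a b : ℝ} (ha : 0 < a) (hb : 0 < b) (n : ℕ) :
    ∫⁻ x, ENNReal.ofReal (x ^ n) ∂(betaMeasure a b) =
      ENNReal.ofReal (beta (a + n) b / beta a b) := by
  have han : 0 < a + n := by positivity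
  have hm : Measurable (betaPDF a b) := (measurable_betaPDFReal a b).ennreal_ofReal
  rw [betaMeasure, lintegral_withDensity_eq_lintegral_mul _ hm (by fun_prop)]
  have : ∀ x, (betaPDF a b * fun x => ENNReal.ofReal (x ^ n)) x =
      ENNReal.ofReal (beta (a + n) b / beta a b) * betaPDF (a + n) b x := by
    intro x
    rw [Pi.mul_apply, betaPDF_eq, betaPDF_eq]
    split_ifs with hx
    · have h1 := beta_pos ha hb
      have h2 := beta_pos han hb
      rw [← ENNReal.ofReal_mul (mul_nonneg (by have := hx.1; positivity)
          (Real.rpow_nonneg (by linarith [hx.2]) _)), ← ENNReal.ofReal_mul (by positivity)]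
      congr 1
      have : x ^ (a + n - 1) = x ^ (a - 1) * x ^ n := by
        rw [← Real.rpow_natCast x n, ← Real.rpow_add hx.1]; ring_nf
      rw [this]
      field_simp
    · simp
  simp_rw [this]
  rw [lintegral_const_mul _ (show Measurable (betaPDF (a + n) b) from
      (measurable_betaPDFReal _ _).ennreal_ofReal),
    lintegral_betaPDF_eq_one han hb, mul_one]

lemma beta_two_div {b : ℝ} (hb : 0 < b) : beta (1 + 1) b / beta 1 b = 1 / (b + 1) := by
  have h1 : Real.Gamma (1 + 1 + b) = (b + 1) * Real.Gamma (b + 1) := by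
    rw [← Real.Gamma_add_one (by positivity)]; ring_nf
  have h2 : Real.Gamma (1 + 1) = 1 := by rw [Real.Gamma_add_one one_ne_zero]; simp
  have h3 := Real.Gamma_pos_of_pos hb
  have h4 := Real.Gamma_pos_of_pos (show 0 < b + 1 by positivity)
  rw [beta, beta, h1, h2, Real.Gamma_one, add_comm 1 b]
  field_simp

lemma beta_three_div {b : ℝ} (hb : 0 < b) :
    beta (1 + 2) b / beta 1 b = 2 / ((b + 1) * (b + 2)) := by
  have h1 : Real.Gamma (1 + 2 + b) = (b + 2) * ((b + 1) * Real.Gamma (b + 1)) := by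
    rw [← Real.Gamma_add_one (s := b + 1) (by positivity), show b + 2 = b + 1 + 1 by ring,
      ← Real.Gamma_add_one (by positivity)]
    ring_nf
  have h2 : Real.Gamma (1 + 2) = 2 := by
    rw [show (1 + 2 : ℝ) = ((2 : ℕ) : ℝ) + 1 by norm_num, Real.Gamma_nat_eq_factorial]; simp
  have h3 := Real.Gamma_pos_of_pos hb
  have h4 := Real.Gamma_pos_of_pos (show 0 < b + 1 by positivity)
  rw [beta, beta, h1, h2, Real.Gamma_one, add_comm 1 b]
  field_simp

lemma betaMeasure_pos {a b : ℝ} (ha : 0 < a) (hb : 0 < b) {U : Set ℝ} (hU : IsOpen U)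
    {x : ℝ} (hx : x ∈ U) (hx01 : x ∈ Set.Icc (0 : ℝ) 1) : 0 < betaMeasure a b U := by
  have hne : (U ∩ Set.Ioo 0 1).Nonempty := by
    rw [← closure_Ioo zero_ne_one] at hx01
    exact mem_closure_iff.1 hx01 U hU hx
  rw [pos_iff_ne_zero]
  intro h0
  rw [betaMeasure, withDensity_apply_eq_zero (show Measurable (betaPDF a b) from
    (measurable_betaPDFReal a b).ennreal_ofReal)] at h0
  have hpos := (hU.inter isOpen_Ioo).measure_pos (volume : Measure ℝ) hne
  refine hpos.ne' (measure_mono_null ?_ h0)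
  rintro y ⟨hyU, hy⟩
  exact ⟨(ENNReal.ofReal_pos.2 (betaPDFReal_pos hy.1 hy.2 ha hb)).ne', hyU⟩

section Moments

variable {Ω : Type*} [MeasurableSpace Ω] {P : Measure Ω}

lemma integral_pow_of_map_eq_betaMeasure {b : ℝ} (hb : 0 < b) {X : Ω → ℝ} (hX : Measurable X)
    (h01 : ∀ ω, X ω ∈ Set.Icc (0 : ℝ) 1) (hlaw : P.map X = betaMeasure 1 b) (n : ℕ) :
    ∫ ω, X ω ^ n ∂P = beta (1 + n) b / beta 1 b := by
  rw [integral_eq_lintegral_of_nonneg_ae (ae_of_all _ fun ω => pow_nonneg (h01 ω).1 n)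
      (by fun_prop),
    ← lintegral_map (f := fun x : ℝ => ENNReal.ofReal (x ^ n)) (by fun_prop) hX, hlaw,
    lintegral_pow_betaMeasure one_pos hb, ENNReal.toReal_ofReal]
  exact (div_pos (beta_pos (by positivity) hb) (beta_pos one_pos hb)).le

/-- Integrating out `X`, which is independent of the coefficients `g₀`, `g₁`, `g₂`. -/
lemma integral_quadratic_of_indep {Ω : Type*} {m : MeasurableSpace Ω} [MeasurableSpace Ω]
    {P : Measure Ω} [IsProbabilityMeasure P] {X : Ω → ℝ}
    (hX : Measurable X)
    (h01 : ∀ ω, X ω ∈ Set.Icc (0 : ℝ) 1)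
    (hind : Indep m (MeasurableSpace.comap X inferInstance) P) {g₀ g₁ g₂ : Ω → ℝ}
    (hg₁ : Measurable[m] g₁) (hg₂ : Measurable[m] g₂)
    (hi₀ : Integrable g₀ P) (hi₁ : Integrable g₁ P) (hi₂ : Integrable g₂ P) :
    ∫ ω, (g₀ ω + g₁ ω * X ω + g₂ ω * X ω ^ 2) ∂P =
      ∫ ω, (g₀ ω + g₁ ω * (∫ ω', X ω' ∂P) + g₂ ω * (∫ ω', X ω' ^ 2 ∂P)) ∂P := by
  have key : ∀ (g : Ω → ℝ) (n : ℕ), Measurable[m] g → Integrable g P →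
      Integrable (fun ω => g ω * X ω ^ n) P ∧
        ∫ ω, g ω * X ω ^ n ∂P = ∫ ω, g ω * (∫ ω', X ω' ^ n ∂P) ∂P := by
    intro g n hg hgi
    have hindep : IndepFun g (fun ω => X ω ^ n) P := by
      have : IndepFun g X P := by
        rw [IndepFun_iff_Indep]
        exact indep_of_indep_of_le_left hind hg.comap_le
      exact this.comp measurable_id (measurable_id.pow_const n)
    refine ⟨hgi.mul_bdd (c := 1) (by fun_prop) (ae_of_all _ fun ω => ?_), ?_⟩
    · rw [Real.norm_of_nonneg (pow_nonneg (h01 ω).1 n)]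
      exact pow_le_one₀ (h01 ω).1 (h01 ω).2
    · rw [integral_mul_const]
      exact hindep.integral_fun_mul_eq_mul_integral hgi.aestronglyMeasurable (by fun_prop)
  obtain ⟨j₁, e₁⟩ := key g₁ 1 hg₁ hi₁
  obtain ⟨j₂, e₂⟩ := key g₂ 2 hg₂ hi₂
  simp only [pow_one] at j₁ e₁
  rw [integral_add (f := fun ω => g₀ ω + g₁ ω * X ω) (hi₀.add j₁) j₂, integral_add hi₀ j₁, e₁, e₂,
    integral_add (f := fun ω => g₀ ω + g₁ ω * ∫ ω', X ω' ∂P)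
      (hi₀.add (hi₁.mul_const _)) (hi₂.mul_const _),
    integral_add hi₀ (hi₁.mul_const _)]

/-- The factor `E[(1 - aX)(1 - bX)]` for a `[0,1]`-valued variable with moments `m₁`, `m₂`. The
last condition on the moments expresses `0 ≤ E[(1 - X)²]`. -/
lemma quadratic_factor_mem {m₁ m₂ a b : ℝ} (h2 : 0 ≤ m₂) (h21 : m₂ ≤ m₁) (h1 : m₁ ≤ 1)
    (h12 : 2 * m₁ ≤ 1 + m₂) (ha : a ∈ Set.Icc (0 : ℝ) 1) (hb : b ∈ Set.Icc (0 : ℝ) 1) :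
    1 - (a + b) * m₁ + a * b * m₂ ∈ Set.Icc (0 : ℝ) 1 := by
  obtain ⟨ha0, ha1⟩ := ha
  obtain ⟨hb0, hb1⟩ := hb
  constructor
  · have e : 1 - (a + b) * m₁ + a * b * m₂ = (1 - a) * (1 - b)
        + (a * (1 - b) + b * (1 - a)) * (1 - m₁) + a * b * (1 + m₂ - 2 * m₁) := by ring
    have := sub_nonneg.2 ha1
    have := sub_nonneg.2 hb1
    have := sub_nonneg.2 h1
    have := sub_nonneg.2 h12
    rw [e]; positivity
  · have h3 : a * b * m₂ ≤ a * 1 * m₁ := by gcongr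
    nlinarith [mul_nonneg hb0 (h2.trans h21)]

/-- The second moment of stick-breaking weights with sticks `a k * X k` and `b k * X k`, where the
`X k` are independent of each other and of the coefficients `a`, `b`: the sticks can be integrated
out one after the other. -/
theorem integral_stickBreak_mul_stickBreak {Ω : Type*} {m : MeasurableSpace Ω}
    [MeasurableSpace Ω] {P : Measure Ω} [IsProbabilityMeasure P]
    (hm : m ≤ ‹MeasurableSpace Ω›)
    {X : ℕ → Ω → ℝ} (hX : ∀ k, Measurable (X k)) (h01 : ∀ k ω, X k ω ∈ Set.Icc (0 : ℝ) 1)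
    (hind : ∀ k, Indep (m ⊔ ⨆ j, ⨆ _ : k + 1 ≤ j, MeasurableSpace.comap (X j) inferInstance)
      (MeasurableSpace.comap (X k) inferInstance) P)
    {m₁ m₂ : ℝ} (e₁ : ∀ k, ∫ ω, X k ω ∂P = m₁) (e₂ : ∀ k, ∫ ω, X k ω ^ 2 ∂P = m₂)
    (h2 : 0 ≤ m₂) (h21 : m₂ ≤ m₁) (h1 : m₁ ≤ 1) (h12 : 2 * m₁ ≤ 1 + m₂)
    {a b : ℕ → Ω → ℝ} (ha : ∀ k, Measurable[m] (a k)) (hb : ∀ k, Measurable[m] (b k))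
    (ha01 : ∀ k ω, a k ω ∈ Set.Icc (0 : ℝ) 1) (hb01 : ∀ k ω, b k ω ∈ Set.Icc (0 : ℝ) 1) (k : ℕ) :
    ∫ ω, stickBreak (fun i => a i ω * X i ω) k * stickBreak (fun i => b i ω * X i ω) k ∂P =
      ∫ ω, m₂ * (a k ω * b k ω * ∏ j ∈ Finset.range k,
        (1 - (a j ω + b j ω) * m₁ + a j ω * b j ω * m₂)) ∂P := by
  set 𝓗 : ℕ → MeasurableSpace Ω := fun k =>
    m ⊔ ⨆ j, ⨆ _ : k ≤ j, MeasurableSpace.comap (X j) inferInstance with h𝓗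
  have h𝓗le : ∀ k, 𝓗 k ≤ ‹MeasurableSpace Ω› := fun k =>
    sup_le hm (iSup_le fun j => iSup_le fun _ => (hX j).comap_le)
  have hm𝓗 : ∀ k, m ≤ 𝓗 k := fun k => le_sup_left
  have hX𝓗 : ∀ k j, k ≤ j → Measurable[𝓗 k] (X j) := fun k j hkj =>
    Measurable.of_comap_le ((le_iSup₂ (f := fun j (_ : k ≤ j) =>
      MeasurableSpace.comap (X j) inferInstance) j hkj).trans le_sup_right)
  have hanti : ∀ k, 𝓗 (k + 1) ≤ 𝓗 k := fun k => sup_le_sup_left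
    (iSup_le fun j => iSup_le fun hj => le_iSup₂ (f := fun j (_ : k ≤ j) =>
      MeasurableSpace.comap (X j) inferInstance) j (by omega)) _
  set r : ℕ → Ω → ℝ := fun j ω => 1 - (a j ω + b j ω) * m₁ + a j ω * b j ω * m₂ with hr
  have hr01 : ∀ j ω, r j ω ∈ Set.Icc (0 : ℝ) 1 := fun j ω =>
    quadratic_factor_mem h2 h21 h1 h12 (ha01 j ω) (hb01 j ω)
  have hrm : ∀ j, Measurable[m] (r j) := fun j =>
    ((measurable_const.sub (((ha j).add (hb j)).mul_const m₁)).add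
      (((ha j).mul (hb j)).mul_const m₂))
  have hprodm : ∀ k, Measurable[m] (fun ω => ∏ j ∈ Finset.range k, r j ω) := fun k =>
    Finset.measurable_prod _ fun j _ => hrm j
  have hprod01 : ∀ k ω, ∏ j ∈ Finset.range k, r j ω ∈ Set.Icc (0 : ℝ) 1 := fun k ω =>
    ⟨Finset.prod_nonneg fun j _ => (hr01 j ω).1,
      Finset.prod_le_one (fun j _ => (hr01 j ω).1) fun j _ => (hr01 j ω).2⟩
  have mul01 : ∀ {x y : ℝ}, x ∈ Set.Icc (0 : ℝ) 1 → y ∈ Set.Icc (0 : ℝ) 1 →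
      x * y ∈ Set.Icc (0 : ℝ) 1 := fun hx hy =>
    ⟨mul_nonneg hx.1 hy.1, mul_le_one₀ hx.2 hy.1 hy.2⟩
  have bint : ∀ (g : Ω → ℝ) (C : ℝ), Measurable g → (∀ ω, |g ω| ≤ C) → Integrable g P :=
    fun g C hg hC => Integrable.of_bound hg.aestronglyMeasurable C (ae_of_all _ hC)
  -- the factors with index below `k` are replaced by their conditional means, in the order of the
  -- indices: each stick is independent of the later sticks and of the coefficients
  have claim : ∀ (k : ℕ) (φ : Ω → ℝ), Measurable[𝓗 k] φ → (∀ ω, φ ω ∈ Set.Icc (0 : ℝ) 1) →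
      ∫ ω, φ ω * ∏ j ∈ Finset.range k, ((1 - a j ω * X j ω) * (1 - b j ω * X j ω)) ∂P =
        ∫ ω, φ ω * ∏ j ∈ Finset.range k, r j ω ∂P := by
    intro k
    induction k with
    | zero => intro φ _ _; simp
    | succ k ih =>
      intro φ hφ hφ01
      have h := ih (fun ω => φ ω * ((1 - a k ω * X k ω) * (1 - b k ω * X k ω)))
        ((hφ.mono (hanti k) le_rfl).mul
          ((measurable_const.sub (((ha k).mono (hm𝓗 k) le_rfl).mul (hX𝓗 k k le_rfl))).mul
          (measurable_const.sub (((hb k).mono (hm𝓗 k) le_rfl).mul (hX𝓗 k k le_rfl)))))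
        (fun ω => by
          have s1 := mul01 (ha01 k ω) (h01 k ω)
          have s2 := mul01 (hb01 k ω) (h01 k ω)
          exact mul01 (hφ01 ω) (mul01 ⟨by linarith [s1.2], by linarith [s1.1]⟩
            ⟨by linarith [s2.2], by linarith [s2.1]⟩))
      have hgm : Measurable[𝓗 (k + 1)] (fun ω => φ ω * ∏ j ∈ Finset.range k, r j ω) :=
        hφ.mul ((hprodm k).mono (hm𝓗 _) le_rfl)
      have hg01 : ∀ ω, φ ω * ∏ j ∈ Finset.range k, r j ω ∈ Set.Icc (0 : ℝ) 1 := fun ω =>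
        mul01 (hφ01 ω) (hprod01 k ω)
      have ham : Measurable[𝓗 (k + 1)] (a k) := (ha k).mono (hm𝓗 _) le_rfl
      have hbm : Measurable[𝓗 (k + 1)] (b k) := (hb k).mono (hm𝓗 _) le_rfl
      have hg1 : Measurable[𝓗 (k + 1)]
          (fun ω => -(φ ω * (∏ j ∈ Finset.range k, r j ω) * (a k ω + b k ω))) :=
        (hgm.mul (ham.add hbm)).neg
      have hg2 : Measurable[𝓗 (k + 1)]
          (fun ω => φ ω * (∏ j ∈ Finset.range k, r j ω) * (a k ω * b k ω)) :=
        hgm.mul (ham.mul hbm)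
      have h' := integral_quadratic_of_indep (hX k) (h01 k) (hind k)
        (g₀ := fun ω => φ ω * ∏ j ∈ Finset.range k, r j ω) hg1 hg2
        (bint _ 1 (hgm.mono (h𝓗le _) le_rfl) fun ω => abs_le.2
          ⟨by linarith [(hg01 ω).1], (hg01 ω).2⟩)
        (bint _ 2 (hg1.mono (h𝓗le _) le_rfl) fun ω => by
          rw [abs_neg, abs_mul, abs_of_nonneg (hg01 ω).1,
            abs_of_nonneg (add_nonneg (ha01 k ω).1 (hb01 k ω).1)]
          nlinarith [(hg01 ω).1, (hg01 ω).2, (ha01 k ω).1, (ha01 k ω).2, (hb01 k ω).1,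
            (hb01 k ω).2])
        (bint _ 1 (hg2.mono (h𝓗le _) le_rfl) fun ω => by
          have := mul01 (hg01 ω) (mul01 (ha01 k ω) (hb01 k ω))
          exact abs_le.2 ⟨by linarith [this.1], this.2⟩)
      calc _ = ∫ ω, φ ω * ((1 - a k ω * X k ω) * (1 - b k ω * X k ω)) *
              ∏ j ∈ Finset.range k, ((1 - a j ω * X j ω) * (1 - b j ω * X j ω)) ∂P := by
            congr 1; ext ω; rw [Finset.prod_range_succ]; ring
        _ = _ := h
        _ = _ := by
            rw [e₁, e₂] at h'
            refine (Eq.trans ?_ h').trans ?_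
            · congr 1; ext ω; ring
            · congr 1; ext ω; rw [Finset.prod_range_succ]; simp only [hr]; ring
  have hs := claim k (fun ω => a k ω * X k ω * (b k ω * X k ω))
    ((((ha k).mono (hm𝓗 k) le_rfl).mul (hX𝓗 k k le_rfl)).mul
      (((hb k).mono (hm𝓗 k) le_rfl).mul (hX𝓗 k k le_rfl)))
    (fun ω => mul01 (mul01 (ha01 k ω) (h01 k ω)) (mul01 (hb01 k ω) (h01 k ω)))
  have hg2 : Measurable[m] (fun ω => a k ω * b k ω * ∏ j ∈ Finset.range k, r j ω) :=
    ((ha k).mul (hb k)).mul (hprodm k)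
  have h' := integral_quadratic_of_indep (P := P) (hX k) (h01 k)
    (indep_of_indep_of_le_left (hind k) (hm𝓗 (k + 1)))
    (g₀ := fun _ => 0) (g₁ := fun _ => 0)
    (g₂ := fun ω => a k ω * b k ω * ∏ j ∈ Finset.range k, r j ω)
    measurable_const hg2 (integrable_const _) (integrable_const _)
    (bint _ 1 (hg2.mono hm le_rfl) fun ω => by
      have := mul01 (mul01 (ha01 k ω) (hb01 k ω)) (hprod01 k ω)
      exact abs_le.2 ⟨by linarith [this.1], this.2⟩)
  rw [e₁, e₂] at h'
  calc _ = ∫ ω, a k ω * X k ω * (b k ω * X k ω) *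
          ∏ j ∈ Finset.range k, ((1 - a j ω * X j ω) * (1 - b j ω * X j ω)) ∂P := by
        congr 1; ext ω; simp only [stickBreak]; rw [Finset.prod_mul_distrib]; ring
    _ = _ := hs
    _ = _ := by
        refine (Eq.trans ?_ h').trans ?_
        · congr 1; ext ω; ring
        · congr 1; ext ω; ring

end Moments

/-! ### The series of the between-cluster factor -/

/-- The first two moments of the beta distribution with parameters `1` and `α` meet the conditions
of `quadratic_factor_mem`. -/
lemma beta_moments {α : ℝ} (hα : 0 < α) :
    0 ≤ 2 / ((α + 1) * (α + 2)) ∧ 2 / ((α + 1) * (α + 2)) ≤ 1 / (α + 1) ∧ 1 / (α + 1) ≤ 1 ∧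
      2 * (1 / (α + 1)) ≤ 1 + 2 / ((α + 1) * (α + 2)) := by
  refine ⟨by positivity, ?_, ?_, ?_⟩
  · rw [div_le_div_iff₀ (by positivity) (by positivity)]; nlinarith
  · rw [div_le_one (by positivity)]; linarith
  · have : 1 + 2 / ((α + 1) * (α + 2)) - 2 * (1 / (α + 1)) = α / (α + 2) := by
      field_simp; ring
    have h : 0 < α / (α + 2) := by positivity
    linarith

section hFactor

variable {V Loc : Type*} {α : ℝ} {K : V → Loc → ℝ}

lemma hTerm_nonneg (hα : 0 < α) (hK : ∀ v g, K v g ∈ Set.Ioc (0 : ℝ) 1) (v v' : V) (γ : ℕ → Loc)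
    (k : ℕ) : 0 ≤ hTerm α K v v' γ k := by
  obtain ⟨h2, h21, h1, h12⟩ := beta_moments hα
  refine mul_nonneg (mul_nonneg (hK _ _).1.le (hK _ _).1.le) (Finset.prod_nonneg fun j _ => ?_)
  have := (quadratic_factor_mem h2 h21 h1 h12 (Set.Ioc_subset_Icc_self (hK v (γ j)))
    (Set.Ioc_subset_Icc_self (hK v' (γ j)))).1
  convert this using 1
  ring

/-- The defect `1 - E[(1 - K s)(1 - K' s)]` of a factor dominates a multiple of `K K'`, so
the terms are dominated by the weights obtained by breaking sticks at these defects. -/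
lemma summable_hTerm (hα : 0 < α) (hK : ∀ v g, K v g ∈ Set.Ioc (0 : ℝ) 1) (v v' : V)
    (γ : ℕ → Loc) : Summable (hTerm α K v v' γ) := by
  obtain ⟨h2, h21, h1, h12⟩ := beta_moments hα
  set d : ℕ → ℝ := fun j => (K v (γ j) + K v' (γ j)) / (α + 1)
    - 2 * K v (γ j) * K v' (γ j) / ((α + 1) * (α + 2)) with hd
  have hd01 : ∀ j, d j ∈ Set.Icc (0 : ℝ) 1 := fun j => by
    have := quadratic_factor_mem h2 h21 h1 h12 (Set.Ioc_subset_Icc_self (hK v (γ j)))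
      (Set.Ioc_subset_Icc_self (hK v' (γ j)))
    have e : d j = 1 - (1 - (K v (γ j) + K v' (γ j)) * (1 / (α + 1))
        + K v (γ j) * K v' (γ j) * (2 / ((α + 1) * (α + 2)))) := by simp only [hd]; ring
    rw [e]
    exact ⟨by linarith [this.2], by linarith [this.1]⟩
  have hsb : Summable (stickBreak d) := by
    refine summable_of_sum_range_le (c := 1) (stickBreak_nonneg hd01) fun n => ?_
    have := one_sub_sum_stickBreak d n
    have h0 : 0 ≤ ∏ i ∈ Finset.range n, (1 - d i) :=
      Finset.prod_nonneg fun i _ => sub_nonneg.2 (hd01 i).2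
    linarith
  refine Summable.of_nonneg_of_le (hTerm_nonneg hα hK v v' γ) (fun k => ?_)
    (hsb.mul_left ((α + 2) / 2))
  have hprod : ∏ j ∈ Finset.range k, (1 - (K v (γ j) + K v' (γ j)) / (α + 1)
      + 2 * K v (γ j) * K v' (γ j) / ((α + 1) * (α + 2))) = ∏ j ∈ Finset.range k, (1 - d j) :=
    Finset.prod_congr rfl fun j _ => by simp only [hd]; ring
  rw [hTerm, hprod, stickBreak, ← mul_assoc]
  refine mul_le_mul_of_nonneg_right ?_ (Finset.prod_nonneg fun i _ => sub_nonneg.2 (hd01 i).2)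
  have ⟨a0, a1⟩ := hK v (γ k)
  have ⟨b0, b1⟩ := hK v' (γ k)
  have e : (α + 2) / 2 * d k - K v (γ k) * K v' (γ k) =
      (α + 2) / (2 * (α + 1)) * (K v (γ k) * (1 - K v' (γ k)) + K v' (γ k) * (1 - K v (γ k))) := by
    simp only [hd]; field_simp; ring
  have h : 0 ≤ (α + 2) / (2 * (α + 1)) *
      (K v (γ k) * (1 - K v' (γ k)) + K v' (γ k) * (1 - K v (γ k))) := by
    have := sub_nonneg.2 a1
    have := sub_nonneg.2 b1
    positivity
  linarith

lemma hFactor_nonneg (hα : 0 < α) (hK : ∀ v g, K v g ∈ Set.Ioc (0 : ℝ) 1) (v v' : V)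
    (γ : ℕ → Loc) : 0 ≤ hFactor α K v v' γ :=
  mul_nonneg (beta_moments hα).1 (tsum_nonneg (hTerm_nonneg hα hK v v' γ))

end hFactor

/-! ### Determining measures by countable and by ordered data -/

/-- Since the σ-algebra is generated by a countable algebra of sets, the exceptional null sets,
which may depend on `B`, can be merged. -/
lemma ae_eq_measure_of_forall_measurableSet {Ω E : Type*} [MeasurableSpace Ω] {P : Measure Ω}
    [MeasurableSpace E] [MeasurableSpace.CountablyGenerated E] {μ ν : Ω → Measure E}
    [∀ ω, IsFiniteMeasure (μ ω)]
    (h : ∀ B, MeasurableSet B → ∀ᵐ ω ∂P, μ ω B = ν ω B) : ∀ᵐ ω ∂P, μ ω = ν ω := by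
  set 𝒜 := generateSetAlgebra (MeasurableSpace.countableGeneratingSet E)
  have hgen : ‹MeasurableSpace E› = MeasurableSpace.generateFrom 𝒜 := by
    rw [generateFrom_generateSetAlgebra_eq, MeasurableSpace.generateFrom_countableGeneratingSet]
  have hc : 𝒜.Countable :=
    countable_generateSetAlgebra MeasurableSpace.countable_countableGeneratingSet
  have h𝒜 : ∀ B ∈ 𝒜, MeasurableSet B := fun B hB => by
    rw [hgen]; exact MeasurableSpace.measurableSet_generateFrom hB
  have hall : ∀ᵐ ω ∂P, ∀ B ∈ 𝒜, μ ω B = ν ω B := (ae_ball_iff hc).2 fun B hB => h B (h𝒜 B hB)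
  filter_upwards [hall] with ω hω
  exact ext_of_generate_finite 𝒜 hgen (fun s hs t ht _ =>
    isSetAlgebra_generateSetAlgebra.inter_mem hs ht) hω
    (hω _ isSetAlgebra_generateSetAlgebra.univ_mem)

/-- The multivariate distribution function determines the joint law. -/
lemma map_eq_map_of_forall_le {Ω ι : Type*} [MeasurableSpace Ω] {P : Measure Ω}
    [IsProbabilityMeasure P] [Finite ι] {X Y : Ω → ι → ℝ} (hX : Measurable X) (hY : Measurable Y)
    (h : ∀ t : ι → ℝ, P {ω | ∀ p, X ω p ≤ t p} = P {ω | ∀ p, Y ω p ≤ t p}) :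
    P.map X = P.map Y := by
  have : IsProbabilityMeasure (P.map X) := Measure.isProbabilityMeasure_map hX.aemeasurable
  have : IsProbabilityMeasure (P.map Y) := Measure.isProbabilityMeasure_map hY.aemeasurable
  refine ext_of_generate_finite
    (Set.pi Set.univ '' Set.pi Set.univ fun _ : ι => Set.range (Set.Iic : ℝ → Set ℝ))
    (generateFrom_eq_pi (fun _ => (borel_eq_generateFrom_Iic ℝ).symm.trans
        (BorelSpace.measurable_eq (α := ℝ)).symm) fun _ =>
      ⟨fun n : ℕ => Set.Iic (n : ℝ), fun n => ⟨_, rfl⟩, Set.iUnion_eq_univ_iff.2 fun x =>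
        (exists_nat_ge x)⟩).symm
    (IsPiSystem.pi fun _ => isPiSystem_Iic) ?_ (by simp)
  rintro s ⟨f, hf, rfl⟩
  choose t ht using fun i => hf i (Set.mem_univ i)
  obtain rfl : f = fun i => Set.Iic (t i) := funext fun i => (ht i).symm
  have hm : MeasurableSet (Set.pi Set.univ fun i => Set.Iic (t i)) :=
    MeasurableSet.univ_pi fun _ => measurableSet_Iic
  rw [Measure.map_apply hX hm, Measure.map_apply hY hm]
  have e : ∀ Z : Ω → ι → ℝ, (Z ⁻¹' Set.pi Set.univ fun i => Set.Iic (t i)) =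
      {ω | ∀ p, Z ω p ≤ t p} := fun Z => by ext; simp [Pi.le_def]
  rw [e, e, h t]

namespace FDnDDP

variable {Ω : Type*} [MeasurableSpace Ω] {P : Measure Ω} {V X Loc : Type*}
  [MeasurableSpace Loc] {q : ℕ} {S : Set (Fin q → ℝ)} {α β : ℝ} {K : V → Loc → ℝ}
  {Ψ : CopulaFamily ((V × X) × Fin q)} {G : V × X → ProbabilityMeasure S}

/-! ### The independent sources of randomness -/

/-- Labels of the sources of randomness: the cluster-level sticks, the inner sticks, the atom
processes, and the sequence of locations. -/
abbrev SourceIndex := ℕ ⊕ (ℕ × ℕ) ⊕ (ℕ × ℕ) ⊕ Unit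

/-- The σ-algebra generated by one source of randomness. -/
@[reducible] def source (H : FDnDDP P α β K Ψ G) : SourceIndex → MeasurableSpace Ω
  | .inl k => MeasurableSpace.comap (H.s k) inferInstance
  | .inr (.inl p) => MeasurableSpace.comap (H.u p.1 p.2) inferInstance
  | .inr (.inr (.inl p)) =>
      MeasurableSpace.comap (fun ω (c : V × X) => H.θ p.1 p.2 c ω) inferInstance
  | .inr (.inr (.inr _)) => MeasurableSpace.comap (fun ω (k : ℕ) => H.Γ k ω) inferInstance

/-- The σ-algebra generated by a set of sources. -/
@[reducible] def sourceSigma (H : FDnDDP P α β K Ψ G) (T : Set SourceIndex) :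
    MeasurableSpace Ω :=
  ⨆ a ∈ T, H.source a

/-- The sources that enter the `k`-th inner random measures. -/
def innerSources (k : ℕ) : Set SourceIndex :=
  {a | ∃ l, a = .inr (.inl (l, k)) ∨ a = .inr (.inr (.inl (l, k)))}

/-- The sources that enter the cluster weights. -/
def outerSources : Set SourceIndex :=
  {a | (∃ k, a = .inl k) ∨ a = .inr (.inr (.inr ()))}

variable (H : FDnDDP P α β K Ψ G)

lemma iIndep_source : iIndep H.source P := by
  convert H.indep using 1
  funext a
  rcases a with k | p | p | u <;> rfl

lemma source_le (a : SourceIndex) : H.source a ≤ ‹MeasurableSpace Ω› := by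
  rcases a with k | p | p | u
  · exact (H.measurable_s k).comap_le
  · exact (H.measurable_u p.1 p.2).comap_le
  · exact (measurable_pi_iff.2 fun c => H.measurable_θ p.1 p.2 c).comap_le
  · exact (measurable_pi_iff.2 fun k => H.measurable_Γ k).comap_le

lemma sourceSigma_le (T : Set SourceIndex) :
    H.sourceSigma T ≤ ‹MeasurableSpace Ω› :=
  iSup₂_le fun a _ => H.source_le a

lemma source_le_sourceSigma {T : Set SourceIndex}
    {a : SourceIndex} (ha : a ∈ T) : H.source a ≤ H.sourceSigma T :=
  le_iSup₂ (f := fun a (_ : a ∈ T) => H.source a) a ha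

lemma indep_sourceSigma {T T' : Set SourceIndex} (h : Disjoint T T') :
    Indep (H.sourceSigma T) (H.sourceSigma T') P :=
  indep_iSup_of_disjoint H.source_le H.iIndep_source h

lemma sigma_le : H.sigma ≤ ‹MeasurableSpace Ω› :=
  sup_le (sup_le (sup_le (iSup_le fun k => (H.measurable_s k).comap_le)
    (iSup_le fun l => iSup_le fun k => (H.measurable_u l k).comap_le))
    (iSup_le fun l => iSup_le fun k => iSup_le fun c => (H.measurable_θ l k c).comap_le))
    (iSup_le fun k => (H.measurable_Γ k).comap_le)

lemma sourceSigma_le_sigma (T : Set SourceIndex) :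
    H.sourceSigma T ≤ H.sigma := by
  refine iSup₂_le fun a _ => ?_
  rcases a with k | p | p | u
  · exact (le_iSup (fun k => MeasurableSpace.comap (H.s k) inferInstance) k).trans
      (le_sup_left.trans (le_sup_left.trans le_sup_left))
  · exact (le_iSup₂ (f := fun l k => MeasurableSpace.comap (H.u l k) inferInstance)
      p.1 p.2).trans (le_sup_right.trans (le_sup_left.trans le_sup_left))
  · refine Measurable.comap_le (@measurable_pi_iff _ _ _ H.sigma _ _ |>.2 fun c => ?_)
    exact Measurable.of_comap_le ((le_iSup (fun c => MeasurableSpace.comap (H.θ p.1 p.2 c)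
      inferInstance) c).trans ((le_iSup₂ (f := fun l k => ⨆ c, MeasurableSpace.comap (H.θ l k c)
      inferInstance) p.1 p.2).trans (le_sup_right.trans le_sup_left)))
  · refine Measurable.comap_le (@measurable_pi_iff _ _ _ H.sigma _ _ |>.2 fun k => ?_)
    exact Measurable.of_comap_le ((le_iSup (fun k => MeasurableSpace.comap (H.Γ k)
      inferInstance) k).trans le_sup_right)

lemma disjoint_innerSources {k m : ℕ} (h : k ≠ m) : Disjoint (innerSources k) (innerSources m) := by
  rw [Set.disjoint_left]
  rintro a ⟨l, rfl | rfl⟩ ⟨l', h' | h'⟩ <;> simp_all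

lemma disjoint_innerSources_outerSources (k : ℕ) : Disjoint (innerSources k) outerSources := by
  rw [Set.disjoint_left]
  rintro a ⟨l, rfl | rfl⟩ (⟨l', h'⟩ | h') <;> simp_all

section Measurability

variable {T : Set SourceIndex}

lemma measurable_s_sourceSigma {k : ℕ} (h : .inl k ∈ T) : Measurable[H.sourceSigma T] (H.s k) :=
  Measurable.of_comap_le (H.source_le_sourceSigma h)

lemma measurable_u_sourceSigma {l k : ℕ} (h : .inr (.inl (l, k)) ∈ T) :
    Measurable[H.sourceSigma T] (H.u l k) :=
  Measurable.of_comap_le (H.source_le_sourceSigma h)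

lemma measurable_θ_sourceSigma {l k : ℕ} (h : .inr (.inr (.inl (l, k))) ∈ T) (c : V × X) :
    Measurable[H.sourceSigma T] (H.θ l k c) :=
  (measurable_pi_apply c).comp (Measurable.of_comap_le (H.source_le_sourceSigma h))

lemma measurable_Γ_sourceSigma (h : .inr (.inr (.inr ())) ∈ T) (k : ℕ) :
    Measurable[H.sourceSigma T] (H.Γ k) :=
  (measurable_pi_apply k).comp (Measurable.of_comap_le (H.source_le_sourceSigma h))

end Measurability

lemma _root_.measurable_stickBreak {Ω : Type*} {m : MeasurableSpace Ω} {b : ℕ → Ω → ℝ}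
    (hb : ∀ i, Measurable (b i)) (k : ℕ) : Measurable (fun ω => stickBreak (fun i => b i ω) k) :=
  (hb k).mul (Finset.measurable_prod _ fun i _ => measurable_const.sub (hb i))

lemma _root_.measurable_tsum_ennreal {Ω : Type*} {m : MeasurableSpace Ω} {f : ℕ → Ω → ℝ≥0∞}
    (hf : ∀ i, Measurable (f i)) : Measurable (fun ω => ∑' i, f i ω) :=
  Measurable.tsum hf

/-! ### Weights and inner random measures -/

/-- The weight of the `l`-th atom of the `k`-th inner random measure. -/
noncomputable def atomWeight (l k : ℕ) (ω : Ω) : ℝ≥0∞ :=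
  ENNReal.ofReal (stickBreak (fun i => H.u i k ω) l)

/-- The mass of `A` under the `k`-th inner random measure, as an explicit function of its sticks
and atoms. -/
noncomputable def innerMass (k : ℕ) (c : V × X) (A : Set S) (ω : Ω) : ℝ≥0∞ :=
  ∑' l, H.atomWeight l k ω * A.indicator 1 (H.θ l k c ω)

lemma measurable_atomWeight {T : Set SourceIndex} {k : ℕ}
    (h : ∀ l, .inr (.inl (l, k)) ∈ T) (l : ℕ) : Measurable[H.sourceSigma T] (H.atomWeight l k) :=
  (measurable_stickBreak (fun i => H.measurable_u_sourceSigma (h i)) l).ennreal_ofReal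

lemma measurable_innerMass (k : ℕ) (c : V × X) {A : Set S} (hA : MeasurableSet A) :
    Measurable[H.sourceSigma (innerSources k)] (H.innerMass k c A) :=
  measurable_tsum_ennreal fun l =>
    (H.measurable_atomWeight (T := innerSources k) (fun l => ⟨l, .inl rfl⟩) l).mul
    ((measurable_one.indicator hA).comp
      (H.measurable_θ_sourceSigma (T := innerSources k) ⟨l, .inr rfl⟩ c))

lemma Fstar_ae_eq_innerMass (k : ℕ) (c : V × X) {A : Set S} (hA : MeasurableSet A) :
    ∀ᵐ ω ∂P, (H.Fstar k c ω : Measure S) A = H.innerMass k c A ω := by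
  filter_upwards [H.Fstar_eq k c A hA] with ω hω
  rw [hω]
  simp [innerMass, atomWeight, Measure.dirac_apply' _ hA]

/-- Evaluation of the inner random probability measure at the whole space. -/
lemma tsum_atomWeight (k : ℕ) (c : V × X) : ∀ᵐ ω ∂P, ∑' l, H.atomWeight l k ω = 1 := by
  filter_upwards [H.Fstar_eq k c Set.univ .univ] with ω hω
  simpa [atomWeight] using hω.symm

lemma Fstar_ae_eq_sum (k : ℕ) (c : V × X) : ∀ᵐ ω ∂P, (H.Fstar k c ω : Measure S) =
    Measure.sum fun l => H.atomWeight l k ω • Measure.dirac (H.θ l k c ω) := by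
  refine ae_eq_measure_of_forall_measurableSet fun B hB => ?_
  filter_upwards [H.Fstar_eq k c B hB] with ω hω
  rw [hω, Measure.sum_apply _ hB]
  rfl

/-- Evaluation of the mixture, a probability measure, at the whole space. -/
lemma tsum_clusterWeight (c : V × X) :
    ∀ᵐ ω ∂P, ∑' k, ENNReal.ofReal (H.clusterWeight k c.1 ω) = 1 := by
  filter_upwards [H.F_eq c Set.univ .univ] with ω hω
  simpa [clusterWeight] using hω.symm

lemma F_ae_eq_sum (c : V × X) : ∀ᵐ ω ∂P, (H.F c ω : Measure S) =
    Measure.sum fun k => ENNReal.ofReal (H.clusterWeight k c.1 ω) •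
      (H.Fstar k c ω : Measure S) := by
  refine ae_eq_measure_of_forall_measurableSet fun B hB => ?_
  filter_upwards [H.F_eq c B hB] with ω hω
  rw [hω, Measure.sum_apply _ hB]
  rfl

lemma measurable_clusterWeight (hK : ∀ v, Measurable (K v)) (k : ℕ) (v : V) :
    Measurable[H.sourceSigma outerSources] (H.clusterWeight k v) :=
  measurable_stickBreak (fun i => ((hK v).comp (H.measurable_Γ_sourceSigma (.inr rfl) i)).mul
    (H.measurable_s_sourceSigma (.inl ⟨i, rfl⟩))) k

lemma clusterWeight_mem (hK : ∀ v g, K v g ∈ Set.Ioc (0 : ℝ) 1) (k : ℕ) (v : V) (ω : Ω) :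
    H.clusterWeight k v ω ∈ Set.Icc (0 : ℝ) 1 := by
  have h : ∀ i, K v (H.Γ i ω) * H.s i ω ∈ Set.Icc (0 : ℝ) 1 := fun i =>
    ⟨mul_nonneg (hK _ _).1.le (H.s_mem i ω).1, mul_le_one₀ (hK _ _).2 (H.s_mem i ω).1
      (H.s_mem i ω).2⟩
  exact ⟨stickBreak_nonneg h k, stickBreak_le_one h k⟩

/-- By the copulas, the joint law of an atom process at two covariates is the same for all
atoms. -/
theorem measure_θ_pair_eq [IsProbabilityMeasure P] (l k l' k' : ℕ) (c c' : V × X) {A B : Set S}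
    (hA : MeasurableSet A) (hB : MeasurableSet B) :
    P {ω | H.θ l k c ω ∈ A ∧ H.θ l k c' ω ∈ B} =
      P {ω | H.θ l' k' c ω ∈ A ∧ H.θ l' k' c' ω ∈ B} := by
  classical
  obtain ⟨A', hA', rfl⟩ := hA
  obtain ⟨B', hB', rfl⟩ := hB
  set J : Finset ((V × X) × Fin q) := ({c, c'} : Finset (V × X)) ×ˢ Finset.univ with hJ
  set Y : ℕ → ℕ → Ω → J → ℝ := fun l k ω p => (H.θ l k p.1.1 ω).1 p.1.2 with hY
  have hYm : ∀ l k, Measurable (Y l k) := fun l k => measurable_pi_iff.2 fun p =>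
    (measurable_pi_apply p.1.2).comp (measurable_subtype_coe.comp (H.measurable_θ l k p.1.1))
  have hmap : P.map (Y l k) = P.map (Y l' k') := by
    refine map_eq_map_of_forall_le (hYm l k) (hYm l' k') fun t => ?_
    rw [← measureReal_eq_measureReal_iff, H.fdd_θ l k J t, H.fdd_θ l' k' J t]
  set D : Set (J → ℝ) := {y | (fun m => y ⟨(c, m), by simp [hJ]⟩) ∈ A' ∧
    (fun m => y ⟨(c', m), by simp [hJ]⟩) ∈ B'} with hD
  have hDm : MeasurableSet D := by
    refine MeasurableSet.inter (s₁ := {y : J → ℝ | (fun m => y ⟨(c, m), by simp [hJ]⟩) ∈ A'})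
      (s₂ := {y : J → ℝ | (fun m => y ⟨(c', m), by simp [hJ]⟩) ∈ B'}) ?_ ?_
    · exact (measurable_pi_iff.2 fun m => measurable_pi_apply _ :
        Measurable fun (y : J → ℝ) (m : Fin q) => y ⟨(c, m), by simp [hJ]⟩) hA'
    · exact (measurable_pi_iff.2 fun m => measurable_pi_apply _ :
        Measurable fun (y : J → ℝ) (m : Fin q) => y ⟨(c', m), by simp [hJ]⟩) hB'
  have := congrArg (fun μ => μ D) hmap
  simp only [Measure.map_apply (hYm _ _) hDm] at this
  exact this

/-! ### Integration over the class indicators -/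

section Allocation

variable {H} {n : ℕ} [IsProbabilityMeasure P]

/-- Conditionally on the sticks, atoms and locations, the classes of a set of clusters are drawn
independently with the cluster weights as probabilities. -/
lemma Allocation.setLIntegral_eq (Z : H.Allocation n) (hKm : ∀ v, Measurable (K v))
    (hK : ∀ v g, K v g ∈ Set.Ioc (0 : ℝ) 1) (T : Finset (Fin n)) (v : Fin n → V) (k : Fin n → ℕ)
    {g : Ω → ℝ≥0∞} (hg : Measurable[H.sigma] g) :
    ∫⁻ ω in {ω | ∀ i ∈ T, Z.ζ i (v i) ω = k i}, g ω ∂P =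
      ∫⁻ ω, (∏ i ∈ T, ENNReal.ofReal (H.clusterWeight (k i) (v i) ω)) * g ω ∂P := by
  set E : Set Ω := {ω | ∀ i ∈ T, Z.ζ i (v i) ω = k i} with hE
  have hEm : MeasurableSet E := by
    have : E = ⋂ i ∈ T, Z.ζ i (v i) ⁻¹' {k i} := by ext; simp [hE]
    rw [this]
    exact Finset.measurableSet_biInter _ fun i _ =>
      Z.measurable_ζ i (v i) (measurableSet_singleton _)
  set w : Ω → ℝ := fun ω => ∏ i ∈ T, H.clusterWeight (k i) (v i) ω with hw
  have hwm : Measurable w := Finset.measurable_prod _ fun i _ =>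
    (H.measurable_clusterWeight hKm (k i) (v i)).mono (H.sourceSigma_le _) le_rfl
  have hw0 : ∀ ω, 0 ≤ w ω := fun ω => Finset.prod_nonneg fun i _ => (H.clusterWeight_mem hK _ _ ω).1
  have hw1 : ∀ ω, w ω ≤ 1 := fun ω => Finset.prod_le_one
    (fun i _ => (H.clusterWeight_mem hK _ _ ω).1) fun i _ => (H.clusterWeight_mem hK _ _ ω).2
  have hwi : Integrable w P := Integrable.of_bound hwm.aestronglyMeasurable 1
    (ae_of_all _ fun ω => by rw [Real.norm_of_nonneg (hw0 ω)]; exact hw1 ω)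
  have hmeas : (P.restrict E).trim H.sigma_le =
      (P.withDensity fun ω => ENNReal.ofReal (w ω)).trim H.sigma_le := by
    refine @Measure.ext _ H.sigma _ _ fun s hs => ?_
    have hs' := H.sigma_le s hs
    rw [trim_measurableSet_eq _ hs, trim_measurableSet_eq _ hs, withDensity_apply _ hs',
      Measure.restrict_apply hs', ← ofReal_integral_eq_lintegral_ofReal hwi.integrableOn
        (ae_of_all _ hw0)]
    have h1 := setIntegral_condExp H.sigma_le (μ := P) (f := E.indicator fun _ => (1 : ℝ))
      ((integrable_const 1).indicator hEm) hs
    rw [setIntegral_congr_ae hs' ((Z.condLaw T v k).mono fun ω h _ => h)] at h1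
    rw [show ∫ ω in s, w ω ∂P = _ from h1, integral_indicator hEm,
      Measure.restrict_restrict hEm, setIntegral_const, smul_eq_mul, mul_one, measureReal_def,
      ENNReal.ofReal_toReal (measure_ne_top _ _), Set.inter_comm]
  calc ∫⁻ ω in E, g ω ∂P = ∫⁻ ω, g ω ∂((P.restrict E).trim H.sigma_le) :=
        (lintegral_trim H.sigma_le hg).symm
    _ = ∫⁻ ω, g ω ∂(P.withDensity fun ω => ENNReal.ofReal (w ω)) := by
        rw [hmeas, lintegral_trim H.sigma_le hg]
    _ = _ := by
        rw [lintegral_withDensity_eq_lintegral_mul _ hwm.ennreal_ofReal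
          (hg.mono H.sigma_le le_rfl)]
        refine lintegral_congr fun ω => ?_
        rw [Pi.mul_apply, hw, ENNReal.ofReal_prod_of_nonneg fun i _ =>
          (H.clusterWeight_mem hK _ _ ω).1]

lemma Allocation.lintegral_class (Z : H.Allocation n) (hKm : ∀ v, Measurable (K v))
    (hK : ∀ v g, K v g ∈ Set.Ioc (0 : ℝ) 1) (i : Fin n) (v : V)
    {Φ : ℕ → Ω → ℝ≥0∞} (hΦ : ∀ k, Measurable[H.sigma] (Φ k)) :
    ∫⁻ ω, Φ (Z.ζ i v ω) ω ∂P =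
      ∑' k, ∫⁻ ω, ENNReal.ofReal (H.clusterWeight k v ω) * Φ k ω ∂P := by
  have hset : ∀ k, MeasurableSet {ω | Z.ζ i v ω = k} := fun k =>
    Z.measurable_ζ i v (measurableSet_singleton k)
  have h : ∀ ω, Φ (Z.ζ i v ω) ω = ∑' k, {ω | Z.ζ i v ω = k}.indicator (Φ k) ω := fun ω => by
    rw [tsum_eq_single (Z.ζ i v ω)]
    · simp
    · intro k hk
      exact Set.indicator_of_notMem (s := {ω | Z.ζ i v ω = k}) (fun h => hk h.symm) _
  simp_rw [h]
  rw [lintegral_tsum fun k => (((hΦ k).mono H.sigma_le le_rfl).indicator (hset k)).aemeasurable]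
  refine tsum_congr fun k => ?_
  rw [lintegral_indicator (hset k)]
  have := Z.setLIntegral_eq hKm hK {i} (fun _ => v) (fun _ => k) (hΦ k)
  simpa using this

lemma Allocation.lintegral_class_class (Z : H.Allocation n) (hKm : ∀ v, Measurable (K v))
    (hK : ∀ v g, K v g ∈ Set.Ioc (0 : ℝ) 1) {i j : Fin n} (hij : i ≠ j) (v v' : V)
    {Φ : ℕ → ℕ → Ω → ℝ≥0∞} (hΦ : ∀ k m, Measurable[H.sigma] (Φ k m)) :
    ∫⁻ ω, Φ (Z.ζ i v ω) (Z.ζ j v' ω) ω ∂P =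
      ∑' k, ∑' m, ∫⁻ ω, ENNReal.ofReal (H.clusterWeight k v ω) *
        ENNReal.ofReal (H.clusterWeight m v' ω) * Φ k m ω ∂P := by
  classical
  have hset : ∀ k m, MeasurableSet {ω | Z.ζ i v ω = k ∧ Z.ζ j v' ω = m} := fun k m =>
    (Z.measurable_ζ i v (measurableSet_singleton k)).inter
      (Z.measurable_ζ j v' (measurableSet_singleton m))
  have h : ∀ ω, Φ (Z.ζ i v ω) (Z.ζ j v' ω) ω =
      ∑' k, ∑' m, {ω | Z.ζ i v ω = k ∧ Z.ζ j v' ω = m}.indicator (Φ k m) ω := fun ω => by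
    rw [tsum_eq_single (Z.ζ i v ω), tsum_eq_single (Z.ζ j v' ω)]
    · simp
    · intro m hm
      exact Set.indicator_of_notMem (fun h => hm h.2.symm) _
    · intro k hk
      exact ENNReal.tsum_eq_zero.2 fun m => Set.indicator_of_notMem (fun h => hk h.1.symm) _
  have hm : ∀ k m, Measurable ({ω | Z.ζ i v ω = k ∧ Z.ζ j v' ω = m}.indicator (Φ k m)) :=
    fun k m => ((hΦ k m).mono H.sigma_le le_rfl).indicator (hset k m)
  simp_rw [h]
  rw [lintegral_tsum fun k => (Measurable.tsum (hm k)).aemeasurable]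
  refine tsum_congr fun k => ?_
  rw [lintegral_tsum fun m => (hm k m).aemeasurable]
  refine tsum_congr fun m => ?_
  rw [lintegral_indicator (hset k m)]
  have := Z.setLIntegral_eq hKm hK {i, j} (fun a => if a = i then v else v')
    (fun a => if a = i then k else m) (hΦ k m)
  simpa [Finset.prod_pair hij, hij.symm] using this

end Allocation

end FDnDDP

/-! ### First and second moments -/

/-- If nonnegative weights with total mass one multiply an array that is `r` on the diagonal and
`t` off the diagonal, the total is `t + (r - t) D`, with `D` the mass of the diagonal. The identity
is arranged without subtraction. -/
lemma ENNReal.tsum_tsum_mul_ite_add {w : ℕ → ℕ → ℝ≥0∞} (hw : ∑' k, ∑' m, w k m = 1) (r t : ℝ≥0∞) :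
    (∑' k, ∑' m, w k m * (if k = m then r else t)) + t * ∑' k, w k k = r * (∑' k, w k k) + t := by
  have h : ∀ k, (∑' m, w k m * (if k = m then r else t)) + t * w k k =
      r * w k k + ∑' m, t * w k m := by
    intro k
    have e : ∀ x : ℝ≥0∞, x = ∑' m, if m = k then x else 0 := fun x => by simp
    rw [e (t * w k k), e (r * w k k), ← ENNReal.tsum_add, ← ENNReal.tsum_add]
    refine tsum_congr fun m => ?_
    by_cases hkm : m = k
    · subst hkm; simp [mul_comm]
    · simp [hkm, Ne.symm hkm, mul_comm]
  calc _ = ∑' k, ((∑' m, w k m * (if k = m then r else t)) + t * w k k) := by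
        rw [ENNReal.tsum_add, ENNReal.tsum_mul_left]
    _ = ∑' k, (r * w k k + ∑' m, t * w k m) := tsum_congr h
    _ = _ := by
        rw [ENNReal.tsum_add, ENNReal.tsum_mul_left]
        simp_rw [ENNReal.tsum_mul_left]
        rw [hw, mul_one]

lemma ENNReal.tsum_mul_tsum (f g : ℕ → ℝ≥0∞) : (∑' k, f k) * ∑' m, g m = ∑' k, ∑' m, f k * g m := by
  simp_rw [ENNReal.tsum_mul_left, ENNReal.tsum_mul_right]

lemma toReal_eq_of_add_eq {x d r t : ℝ≥0∞} (hd : d ≠ ∞) (hr : r ≠ ∞) (ht : t ≠ ∞)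
    (h : x + t * d = r * d + t) :
    x.toReal = t.toReal + (r.toReal - t.toReal) * d.toReal := by
  have hx : x ≠ ∞ := by
    refine ne_top_of_le_ne_top (ENNReal.add_ne_top.2 ⟨ENNReal.mul_ne_top hr hd, ht⟩) ?_
    rw [← h]; exact le_self_add
  have := congrArg ENNReal.toReal h
  rw [ENNReal.toReal_add hx (ENNReal.mul_ne_top ht hd),
    ENNReal.toReal_add (ENNReal.mul_ne_top hr hd) ht, ENNReal.toReal_mul,
    ENNReal.toReal_mul] at this
  linarith

section

variable {Ω : Type*} [MeasurableSpace Ω] {P : Measure Ω}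

lemma tsum_tsum_lintegral_mul [IsProbabilityMeasure P] {p p' : ℕ → Ω → ℝ≥0∞}
    (hp : ∀ k, Measurable (p k)) (hp' : ∀ k, Measurable (p' k)) (h1 : ∀ᵐ ω ∂P, ∑' k, p k ω = 1)
    (h1' : ∀ᵐ ω ∂P, ∑' k, p' k ω = 1) : ∑' k, ∑' m, ∫⁻ ω, p k ω * p' m ω ∂P = 1 := by
  calc _ = ∫⁻ ω, (∑' k, p k ω) * ∑' m, p' m ω ∂P := by
        simp_rw [ENNReal.tsum_mul_tsum]
        rw [lintegral_tsum fun k => (measurable_tsum_ennreal fun m =>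
          (hp k).fun_mul (hp' m)).aemeasurable]
        exact tsum_congr fun k =>
          (lintegral_tsum fun m => ((hp k).fun_mul (hp' m)).aemeasurable).symm
    _ = ∫⁻ _, 1 ∂P := lintegral_congr_ae (by filter_upwards [h1, h1'] with ω h h'; simp [h, h'])
    _ = 1 := by simp

lemma lintegral_ofReal_mul_ofReal [IsProbabilityMeasure P] {f g : Ω → ℝ} (hf : Measurable f)
    (hg : Measurable g) (hf01 : ∀ ω, f ω ∈ Set.Icc (0 : ℝ) 1)
    (hg01 : ∀ ω, g ω ∈ Set.Icc (0 : ℝ) 1) :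
    ∫⁻ ω, ENNReal.ofReal (f ω) * ENNReal.ofReal (g ω) ∂P = ENNReal.ofReal (∫ ω, f ω * g ω ∂P) := by
  have h0 : ∀ ω, 0 ≤ f ω * g ω := fun ω => mul_nonneg (hf01 ω).1 (hg01 ω).1
  have hi : Integrable (fun ω => f ω * g ω) P :=
    Integrable.of_bound (hf.mul hg).aestronglyMeasurable 1 (ae_of_all _ fun ω => by
      rw [Real.norm_of_nonneg (h0 ω)]
      exact mul_le_one₀ (hf01 ω).2 (hg01 ω).1 (hg01 ω).2)
  rw [ofReal_integral_eq_lintegral_ofReal hi (ae_of_all _ h0)]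
  exact lintegral_congr fun ω => (ENNReal.ofReal_mul (hf01 ω).1).symm

end

namespace FDnDDP

variable {Ω : Type*} [MeasurableSpace Ω] {P : Measure Ω} {V X Loc : Type*}
  [MeasurableSpace Loc] {q : ℕ} {S : Set (Fin q → ℝ)} {α β : ℝ} {K : V → Loc → ℝ}
  {Ψ : CopulaFamily ((V × X) × Fin q)} {G : V × X → ProbabilityMeasure S}

variable (H : FDnDDP P α β K Ψ G)

/-- Functions of disjoint sets of sources are independent. -/
lemma lintegral_mul_of_disjoint {T T' : Set SourceIndex} (h : Disjoint T T')
    {f g : Ω → ℝ≥0∞} (hf : Measurable[H.sourceSigma T] f) (hg : Measurable[H.sourceSigma T'] g) :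
    ∫⁻ ω, f ω * g ω ∂P = (∫⁻ ω, f ω ∂P) * ∫⁻ ω, g ω ∂P :=
  lintegral_mul_eq_lintegral_mul_lintegral_of_independent_measurableSpace (H.sourceSigma_le T)
    (H.sourceSigma_le T') (H.indep_sourceSigma h) hf hg

lemma sourceSigma_mono {T T' : Set SourceIndex} (h : T ⊆ T') :
    H.sourceSigma T ≤ H.sourceSigma T' :=
  biSup_mono fun _ ha => h ha

/-- The sources of the sticks of the `k`-th inner random measures. -/
def stickSources (k : ℕ) : Set SourceIndex := {a | ∃ l, a = .inr (.inl (l, k))}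

/-- The sources of the atoms of the `k`-th inner random measures. -/
def atomSources (k : ℕ) : Set SourceIndex :=
  {a | ∃ l, a = .inr (.inr (.inl (l, k)))}

lemma disjoint_stickSources_atomSources (k : ℕ) : Disjoint (stickSources k) (atomSources k) := by
  rw [Set.disjoint_left]
  rintro a ⟨l, rfl⟩ ⟨l', h'⟩
  simp_all

lemma measurable_indicator_θ {T : Set SourceIndex} {l k : ℕ}
    (h : .inr (.inr (.inl (l, k))) ∈ T) (c : V × X) {A : Set S} (hA : MeasurableSet A) :
    Measurable[H.sourceSigma T] fun ω => A.indicator (1 : S → ℝ≥0∞) (H.θ l k c ω) :=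
  (measurable_one.indicator hA).comp (H.measurable_θ_sourceSigma h c)

lemma lintegral_indicator_θ (l k : ℕ) (c : V × X) {A : Set S} (hA : MeasurableSet A) :
    ∫⁻ ω, A.indicator (1 : S → ℝ≥0∞) (H.θ l k c ω) ∂P = (G c : Measure S) A := by
  rw [← H.law_θ l k c, ← lintegral_map (measurable_one.indicator hA) (H.measurable_θ l k c),
    lintegral_indicator_one hA]

lemma measurable_atomWeight' (l k : ℕ) : Measurable (H.atomWeight l k) :=
  (H.measurable_atomWeight (T := stickSources k) (fun l => ⟨l, rfl⟩) l).mono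
    (H.sourceSigma_le _) le_rfl

lemma stickBreak_u_mem (l k : ℕ) (ω : Ω) :
    stickBreak (fun i => H.u i k ω) l ∈ Set.Icc (0 : ℝ) 1 :=
  ⟨stickBreak_nonneg (fun i => H.u_mem i k ω) l, stickBreak_le_one (fun i => H.u_mem i k ω) l⟩

lemma measurable_hFactor_Γ (hKm : ∀ v, Measurable (K v)) (v v' : V) :
    Measurable fun ω => hFactor α K v v' (fun m => H.Γ m ω) := by
  have h : ∀ v i, Measurable fun ω => K v (H.Γ i ω) := fun v i => (hKm v).comp (H.measurable_Γ i)
  refine measurable_const.mul (Measurable.tsum fun k => ?_)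
  refine ((h v k).mul (h v' k)).mul (Finset.measurable_prod _ fun j _ => ?_)
  exact (measurable_const.sub (((h v j).add (h v' j)).div_const _)).add
    (((measurable_const.mul (h v j)).mul (h v' j)).div_const _)

variable [IsProbabilityMeasure P]

lemma lintegral_innerMass (k : ℕ) (c : V × X) {A : Set S} (hA : MeasurableSet A) :
    ∫⁻ ω, H.innerMass k c A ω ∂P = (G c : Measure S) A := by
  have hθ : ∀ l, Measurable[H.sourceSigma (atomSources k)] fun ω =>
      A.indicator (1 : S → ℝ≥0∞) (H.θ l k c ω) :=
    fun l => H.measurable_indicator_θ (T := atomSources k) ⟨l, rfl⟩ c hA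
  have hW := H.measurable_atomWeight (T := stickSources k) (k := k) fun l => ⟨l, rfl⟩
  simp only [innerMass]
  rw [lintegral_tsum fun l => (((hW l).mono (H.sourceSigma_le _) le_rfl).fun_mul
    ((hθ l).mono (H.sourceSigma_le _) le_rfl)).aemeasurable]
  simp_rw [fun l => H.lintegral_mul_of_disjoint (disjoint_stickSources_atomSources k) (hW l) (hθ l),
    H.lintegral_indicator_θ _ k c hA]
  rw [ENNReal.tsum_mul_right, ← lintegral_tsum fun l => (H.measurable_atomWeight' l k).aemeasurable,
    lintegral_congr_ae (H.tsum_atomWeight k c)]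
  simp

/-- The joint probability `P(θ_l(c) ∈ A, θ_m(c') ∈ B)` within the `k`-th inner measures. -/
lemma lintegral_indicator_θ_mul (l m k : ℕ) (c c' : V × X) {A B : Set S} (hA : MeasurableSet A)
    (hB : MeasurableSet B) :
    ∫⁻ ω, A.indicator (1 : S → ℝ≥0∞) (H.θ l k c ω) * B.indicator (1 : S → ℝ≥0∞) (H.θ m k c' ω) ∂P =
      if l = m then P {ω | H.θ 0 0 c ω ∈ A ∧ H.θ 0 0 c' ω ∈ B}
      else (G c : Measure S) A * (G c' : Measure S) B := by
  split_ifs with hlm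
  · subst hlm
    have hm : MeasurableSet {ω | H.θ l k c ω ∈ A ∧ H.θ l k c' ω ∈ B} :=
      (H.measurable_θ l k c hA).inter (H.measurable_θ l k c' hB)
    rw [← H.measure_θ_pair_eq l k 0 0 c c' hA hB, ← lintegral_indicator_one hm]
    refine lintegral_congr fun ω => ?_
    by_cases h1 : H.θ l k c ω ∈ A <;> by_cases h2 : H.θ l k c' ω ∈ B <;>
      simp [Set.indicator, h1, h2]
  · have h1 := H.measurable_indicator_θ
      (T := ({.inr (.inr (.inl (l, k)))} : Set SourceIndex)) rfl c hA
    have h2 := H.measurable_indicator_θ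
      (T := ({.inr (.inr (.inl (m, k)))} : Set SourceIndex)) rfl c' hB
    have hd : Disjoint ({.inr (.inr (.inl (l, k)))} : Set SourceIndex)
        {.inr (.inr (.inl (m, k)))} := by
      rw [Set.disjoint_singleton]
      simp [hlm]
    rw [H.lintegral_mul_of_disjoint hd h1 h2,
      H.lintegral_indicator_θ l k c hA, H.lintegral_indicator_θ m k c' hB]

/-- The expected sum of the squared inner weights. -/
lemma tsum_lintegral_atomWeight_sq (hβ : 0 < β) (k : ℕ) :
    ∑' l, ∫⁻ ω, H.atomWeight l k ω * H.atomWeight l k ω ∂P = ENNReal.ofReal (1 / (β + 1)) := by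
  obtain ⟨h2, h21, h1, h12⟩ := beta_moments hβ
  have hu : ∀ l, Measurable (H.u l k) := fun l => H.measurable_u l k
  have e1 : ∀ l, ∫ ω, H.u l k ω ∂P = 1 / (β + 1) := fun l => by
    have := integral_pow_of_map_eq_betaMeasure hβ (hu l) (H.u_mem l k) (H.law_u l k) 1
    simpa [← beta_two_div hβ] using this
  have e2 : ∀ l, ∫ ω, H.u l k ω ^ 2 ∂P = 2 / ((β + 1) * (β + 2)) := fun l => by
    have := integral_pow_of_map_eq_betaMeasure hβ (hu l) (H.u_mem l k) (H.law_u l k) 2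
    simpa [← beta_three_div hβ] using this
  have hind : ∀ l, Indep (⊥ ⊔ ⨆ j, ⨆ _ : l + 1 ≤ j, MeasurableSpace.comap (H.u j k) inferInstance)
      (MeasurableSpace.comap (H.u l k) inferInstance) P := by
    intro l
    set T : Set SourceIndex := {a | ∃ j, l + 1 ≤ j ∧ a = .inr (.inl (j, k))} with hT
    set T' : Set SourceIndex := {.inr (.inl (l, k))} with hT'
    have hd : Disjoint T T' := by
      rw [Set.disjoint_singleton_right]
      rintro ⟨j, hj, h⟩
      simp only [Sum.inr.injEq, Sum.inl.injEq, Prod.mk.injEq] at h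
      omega
    refine indep_of_indep_of_le (H.indep_sourceSigma hd)
      (sup_le bot_le (iSup₂_le fun j hj => ?_)) ?_
    · exact (H.measurable_u_sourceSigma (T := T) ⟨j, hj, rfl⟩).comap_le
    · exact (H.measurable_u_sourceSigma (T := T') rfl).comap_le
  have key := integral_stickBreak_mul_stickBreak (m := ⊥) bot_le hu (fun l => H.u_mem l k) hind
    e1 e2 h2 h21 h1 h12 (a := fun _ _ => 1) (b := fun _ _ => 1)
    (fun _ => measurable_const) (fun _ => measurable_const) (fun _ _ => by simp)
    (fun _ _ => by simp)
  set r : ℝ := 1 - (1 + 1) * (1 / (β + 1)) + 2 / ((β + 1) * (β + 2)) with hr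
  have hre : r = β / (β + 2) := by rw [hr]; field_simp; ring
  have hr0 : 0 ≤ r := by rw [hre]; positivity
  have hr1 : r < 1 := by rw [hre, div_lt_one (by positivity)]; linarith
  have hterm : ∀ l, ∫⁻ ω, H.atomWeight l k ω * H.atomWeight l k ω ∂P =
      ENNReal.ofReal (2 / ((β + 1) * (β + 2)) * r ^ l) := fun l => by
    have hm := measurable_stickBreak hu l
    simp only [atomWeight]
    rw [lintegral_ofReal_mul_ofReal hm hm (H.stickBreak_u_mem l k) (H.stickBreak_u_mem l k)]
    have := key l
    simp only [one_mul, Finset.prod_const, Finset.card_range] at this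
    rw [this]
    simp [hr]
  simp_rw [hterm]
  rw [← ENNReal.ofReal_tsum_of_nonneg (fun l => mul_nonneg h2 (pow_nonneg hr0 l))
    ((summable_geometric_of_lt_one hr0 hr1).mul_left _), tsum_mul_left,
    tsum_geometric_of_lt_one hr0 hr1, hre]
  congr 1
  have : 1 - β / (β + 2) = 2 / (β + 2) := by field_simp; ring
  rw [this]
  field_simp

/-- Mixed second moment of an inner random measure at two covariates. -/
lemma lintegral_innerMass_mul_self (hβ : 0 < β) (k : ℕ) (c c' : V × X) {A B : Set S}
    (hA : MeasurableSet A) (hB : MeasurableSet B) :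
    (∫⁻ ω, H.innerMass k c A ω * H.innerMass k c' B ω ∂P) +
        (G c : Measure S) A * (G c' : Measure S) B * ENNReal.ofReal (1 / (β + 1)) =
      P {ω | H.θ 0 0 c ω ∈ A ∧ H.θ 0 0 c' ω ∈ B} * ENNReal.ofReal (1 / (β + 1)) +
        (G c : Measure S) A * (G c' : Measure S) B := by
  have hθA : ∀ l, Measurable[H.sourceSigma (atomSources k)] fun ω =>
      A.indicator (1 : S → ℝ≥0∞) (H.θ l k c ω) :=
    fun l => H.measurable_indicator_θ (T := atomSources k) ⟨l, rfl⟩ c hA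
  have hθB : ∀ l, Measurable[H.sourceSigma (atomSources k)] fun ω =>
      B.indicator (1 : S → ℝ≥0∞) (H.θ l k c' ω) :=
    fun l => H.measurable_indicator_θ (T := atomSources k) ⟨l, rfl⟩ c' hB
  have hW := H.measurable_atomWeight (T := stickSources k) (k := k) fun l => ⟨l, rfl⟩
  have hm : ∀ l m, Measurable fun ω => H.atomWeight l k ω * A.indicator 1 (H.θ l k c ω) *
      (H.atomWeight m k ω * B.indicator 1 (H.θ m k c' ω)) := fun l m =>
    (((hW l).mono (H.sourceSigma_le _) le_rfl).mul
      ((hθA l).mono (H.sourceSigma_le _) le_rfl)).mul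
    (((hW m).mono (H.sourceSigma_le _) le_rfl).mul ((hθB m).mono (H.sourceSigma_le _) le_rfl))
  have hexp : ∫⁻ ω, H.innerMass k c A ω * H.innerMass k c' B ω ∂P =
      ∑' l, ∑' m, (∫⁻ ω, H.atomWeight l k ω * H.atomWeight m k ω ∂P) *
        (if l = m then P {ω | H.θ 0 0 c ω ∈ A ∧ H.θ 0 0 c' ω ∈ B}
          else (G c : Measure S) A * (G c' : Measure S) B) := by
    simp only [innerMass, ENNReal.tsum_mul_tsum]
    rw [lintegral_tsum fun l => (measurable_tsum_ennreal fun m => hm l m).aemeasurable]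
    refine tsum_congr fun l => ?_
    rw [lintegral_tsum fun m => (hm l m).aemeasurable]
    refine tsum_congr fun m => ?_
    simp_rw [mul_mul_mul_comm (H.atomWeight l k _)]
    rw [H.lintegral_mul_of_disjoint (disjoint_stickSources_atomSources k) ((hW l).fun_mul (hW m))
      ((hθA l).fun_mul (hθB m)), H.lintegral_indicator_θ_mul l m k c c' hA hB]
  rw [hexp, ← H.tsum_lintegral_atomWeight_sq hβ k]
  exact ENNReal.tsum_tsum_mul_ite_add (tsum_tsum_lintegral_mul
    (fun l => H.measurable_atomWeight' l k)
    (fun l => H.measurable_atomWeight' l k) (H.tsum_atomWeight k c) (H.tsum_atomWeight k c)) _ _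

lemma lintegral_innerMass_mul_of_ne {k m : ℕ} (hkm : k ≠ m) (c c' : V × X) {A B : Set S}
    (hA : MeasurableSet A) (hB : MeasurableSet B) :
    ∫⁻ ω, H.innerMass k c A ω * H.innerMass m c' B ω ∂P =
      (G c : Measure S) A * (G c' : Measure S) B := by
  rw [H.lintegral_mul_of_disjoint (disjoint_innerSources hkm) (H.measurable_innerMass k c hA)
    (H.measurable_innerMass m c' hB), H.lintegral_innerMass k c hA, H.lintegral_innerMass m c' hB]

/-- The probability that two clusters fall into the same class. -/
lemma tsum_lintegral_clusterWeight_mul (hα : 0 < α) (hKm : ∀ v, Measurable (K v))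
    (hK : ∀ v g, K v g ∈ Set.Ioc (0 : ℝ) 1) (v v' : V) :
    ∑' k, ∫⁻ ω, ENNReal.ofReal (H.clusterWeight k v ω) *
        ENNReal.ofReal (H.clusterWeight k v' ω) ∂P =
      ∫⁻ ω, ENNReal.ofReal (hFactor α K v v' (fun m => H.Γ m ω)) ∂P := by
  obtain ⟨h2, h21, h1, h12⟩ := beta_moments hα
  have e1 : ∀ k, ∫ ω, H.s k ω ∂P = 1 / (α + 1) := fun k => by
    have := integral_pow_of_map_eq_betaMeasure hα (H.measurable_s k) (H.s_mem k) (H.law_s k) 1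
    simpa [← beta_two_div hα] using this
  have e2 : ∀ k, ∫ ω, H.s k ω ^ 2 ∂P = 2 / ((α + 1) * (α + 2)) := fun k => by
    have := integral_pow_of_map_eq_betaMeasure hα (H.measurable_s k) (H.s_mem k) (H.law_s k) 2
    simpa [← beta_three_div hα] using this
  set T₀ : Set SourceIndex := {.inr (.inr (.inr ()))} with hT₀
  have hind : ∀ k, Indep (H.sourceSigma T₀ ⊔
      ⨆ j, ⨆ _ : k + 1 ≤ j, MeasurableSpace.comap (H.s j) inferInstance)
      (MeasurableSpace.comap (H.s k) inferInstance) P := by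
    intro k
    set T : Set SourceIndex := {a | (∃ j, k + 1 ≤ j ∧ a = .inl j) ∨ a = .inr (.inr (.inr ()))}
      with hT
    set T' : Set SourceIndex := {.inl k} with hT'
    have hd : Disjoint T T' := by
      rw [Set.disjoint_singleton_right]
      rintro (⟨j, hj, h⟩ | h)
      · simp only [Sum.inl.injEq] at h
        omega
      · simp at h
    refine indep_of_indep_of_le (H.indep_sourceSigma hd)
      (sup_le (H.sourceSigma_mono fun a ha => .inr ha) (iSup₂_le fun j hj => ?_)) ?_
    · exact (H.measurable_s_sourceSigma (T := T) (.inl ⟨j, hj, rfl⟩)).comap_le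
    · exact (H.measurable_s_sourceSigma (T := T') rfl).comap_le
  have hKΓ : ∀ v i, Measurable[H.sourceSigma T₀] fun ω => K v (H.Γ i ω) := fun v i =>
    (hKm v).comp (H.measurable_Γ_sourceSigma (T := T₀) rfl i)
  have key := fun k => integral_stickBreak_mul_stickBreak (H.sourceSigma_le _) H.measurable_s
    H.s_mem hind e1 e2 h2 h21 h1 h12 (a := fun i ω => K v (H.Γ i ω))
    (b := fun i ω => K v' (H.Γ i ω))
    (hKΓ v) (hKΓ v') (fun _ _ => Set.Ioc_subset_Icc_self (hK _ _))
    (fun _ _ => Set.Ioc_subset_Icc_self (hK _ _)) k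
  have hT : ∀ k ω, K v (H.Γ k ω) * K v' (H.Γ k ω) * ∏ j ∈ Finset.range k,
      (1 - (K v (H.Γ j ω) + K v' (H.Γ j ω)) * (1 / (α + 1)) + K v (H.Γ j ω) * K v' (H.Γ j ω) *
        (2 / ((α + 1) * (α + 2)))) = hTerm α K v v' (fun m => H.Γ m ω) k := fun k ω => by
    rw [hTerm]
    congr 1
    exact Finset.prod_congr rfl fun j _ => by ring
  have hTm : ∀ k, Measurable fun ω => hTerm α K v v' (fun m => H.Γ m ω) k := fun k => by
    have h : ∀ v i, Measurable fun ω => K v (H.Γ i ω) := fun v i => (hKm v).comp (H.measurable_Γ i)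
    refine ((h v k).mul (h v' k)).mul (Finset.measurable_prod _ fun j _ => ?_)
    exact (measurable_const.sub (((h v j).add (h v' j)).div_const _)).add
      (((measurable_const.mul (h v j)).mul (h v' j)).div_const _)
  have hT1 : ∀ k ω, hTerm α K v v' (fun m => H.Γ m ω) k ≤ 1 := fun k ω => by
    rw [← hT]
    refine mul_le_one₀ (mul_le_one₀ (hK _ _).2 (hK _ _).1.le (hK _ _).2)
      (Finset.prod_nonneg fun j _ => ?_) (Finset.prod_le_one (fun j _ => ?_) fun j _ => ?_)
    all_goals
      have := quadratic_factor_mem h2 h21 h1 h12 (Set.Ioc_subset_Icc_self (hK v (H.Γ j ω)))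
        (Set.Ioc_subset_Icc_self (hK v' (H.Γ j ω)))
      first | exact this.1 | exact this.2
  have hterm : ∀ k, ∫⁻ ω, ENNReal.ofReal (H.clusterWeight k v ω) *
      ENNReal.ofReal (H.clusterWeight k v' ω) ∂P =
      ∫⁻ ω, ENNReal.ofReal (2 / ((α + 1) * (α + 2)) * hTerm α K v v' (fun m => H.Γ m ω) k) ∂P := by
    intro k
    have hcm := fun v => (H.measurable_clusterWeight hKm k v).mono (H.sourceSigma_le _) le_rfl
    rw [lintegral_ofReal_mul_ofReal (hcm v) (hcm v') (H.clusterWeight_mem hK k v)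
      (H.clusterWeight_mem hK k v'), ← ofReal_integral_eq_lintegral_ofReal]
    · rw [show ∫ ω, H.clusterWeight k v ω * H.clusterWeight k v' ω ∂P = _ from key k]
      simp_rw [hT]
    · refine (Integrable.of_bound (hTm k).aestronglyMeasurable 1
        (ae_of_all _ fun ω => ?_)).const_mul _
      rw [Real.norm_of_nonneg (hTerm_nonneg hα hK v v' _ k)]
      exact hT1 k ω
    · exact ae_of_all _ fun ω => mul_nonneg h2 (hTerm_nonneg hα hK v v' _ k)
  simp_rw [hterm]
  rw [← lintegral_tsum fun k => ((hTm k).const_mul _).ennreal_ofReal.aemeasurable]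
  refine lintegral_congr fun ω => ?_
  rw [hFactor, ← tsum_mul_left, ENNReal.ofReal_tsum_of_nonneg
    (fun k => mul_nonneg h2 (hTerm_nonneg hα hK v v' _ k))
    ((summable_hTerm hα hK v v' _).mul_left _)]

end FDnDDP

namespace FDnDDP

variable {Ω : Type*} [MeasurableSpace Ω] {P : Measure Ω} {V X Loc : Type*}
  [MeasurableSpace Loc] {q : ℕ} {S : Set (Fin q → ℝ)} {α β : ℝ} {K : V → Loc → ℝ}
  {Ψ : CopulaFamily ((V × X) × Fin q)} {G : V × X → ProbabilityMeasure S}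

/-! ### Moments of the random measures of the clusters -/

/-- Two atoms of one inner random measure coincide with probability `1 / (β + 1)`, and are
independent otherwise. -/
lemma lintegral_innerMass_mul_self_eq [IsProbabilityMeasure P] (H : FDnDDP P α β K Ψ G)
    (hβ : 0 < β) (k : ℕ) (c c' : V × X) {A B : Set S}
    (hA : MeasurableSet A) (hB : MeasurableSet B) :
    ∫⁻ ω, H.innerMass k c A ω * H.innerMass k c' B ω ∂P =
      ENNReal.ofReal ((G c : Measure S).real A * (G c' : Measure S).real B +
        (P.real {ω | H.θ 0 0 c ω ∈ A ∧ H.θ 0 0 c' ω ∈ B} -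
          (G c : Measure S).real A * (G c' : Measure S).real B) / (β + 1)) := by
  have h := H.lintegral_innerMass_mul_self hβ k c c' hA hB
  have ht : (G c : Measure S) A * (G c' : Measure S) B ≠ ∞ :=
    ENNReal.mul_ne_top (measure_ne_top _ _) (measure_ne_top _ _)
  have hr := measure_ne_top P {ω | H.θ 0 0 c ω ∈ A ∧ H.θ 0 0 c' ω ∈ B}
  have hx : ∫⁻ ω, H.innerMass k c A ω * H.innerMass k c' B ω ∂P ≠ ∞ := by
    refine ne_top_of_le_ne_top (ENNReal.add_ne_top.2
      ⟨ENNReal.mul_ne_top hr (ENNReal.ofReal_ne_top (r := 1 / (β + 1))), ht⟩) ?_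
    rw [← h]; exact le_self_add
  rw [← ENNReal.ofReal_toReal hx, toReal_eq_of_add_eq ENNReal.ofReal_ne_top hr ht h,
    ENNReal.toReal_mul, ENNReal.toReal_ofReal (by positivity), mul_one_div]
  rfl

namespace Allocation

variable {H : FDnDDP P α β K Ψ G} {n : ℕ} (Z : H.Allocation n)

lemma clusterF_ae_eq (i : Fin n) (c : V × X) {A : Set S} (hA : MeasurableSet A) :
    ∀ᵐ ω ∂P, (Z.clusterF i c ω : Measure S) A = H.innerMass (Z.ζ i c.1 ω) c A ω := by
  filter_upwards [ae_all_iff.2 fun k => H.Fstar_ae_eq_innerMass k c hA] with ω hω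
  exact hω _

lemma measurable_innerMass_class (i : Fin n) (c : V × X) {A : Set S} (hA : MeasurableSet A) :
    Measurable fun ω => H.innerMass (Z.ζ i c.1 ω) c A ω :=
  (measurable_from_prod_countable_right (f := fun p : ℕ × Ω => H.innerMass p.1 c A p.2) fun k =>
    (H.measurable_innerMass k c hA).mono (H.sourceSigma_le _) le_rfl).comp
    ((Z.measurable_ζ i c.1).prodMk measurable_id)

/-- Correlation from a covariance that is a multiple of the covariance of the atoms. -/
lemma _root_.corr_eq_mul_corrRatio {Y Y' : Ω → ℝ} {ρ a b β h : ℝ} (hβ : 0 < β)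
    (hcov : cov[Y, Y'; P] = h * ((ρ - a * b) / (β + 1)))
    (hY : Var[Y; P] = a * (1 - a) / (β + 1)) (hY' : Var[Y'; P] = b * (1 - b) / (β + 1)) :
    corr Y Y' P = h * corrRatio ρ a b := by
  have e : a * (1 - a) / (β + 1) * (b * (1 - b) / (β + 1)) =
      a * (1 - a) * b * (1 - b) / (β + 1) ^ 2 := by
    field_simp
  rw [corr, corrRatio, hcov, hY, hY', e, Real.sqrt_div' _ (by positivity),
    Real.sqrt_sq (by positivity)]
  field_simp

variable [IsProbabilityMeasure P]

lemma memLp_clusterF (i : Fin n) (c : V × X) {A : Set S} (hA : MeasurableSet A) :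
    MemLp (fun ω => (Z.clusterF i c ω : Measure S).real A) 2 P := by
  refine MemLp.of_bound ?_ 1 (ae_of_all _ fun ω => ?_)
  · refine ((Z.measurable_innerMass_class i c hA).ennreal_toReal.aemeasurable.congr
      ?_).aestronglyMeasurable
    filter_upwards [Z.clusterF_ae_eq i c hA] with ω hω
    rw [measureReal_def, hω]
  · rw [Real.norm_of_nonneg measureReal_nonneg]
    exact measureReal_le_one

lemma integral_clusterF_mul (i j : Fin n) (c c' : V × X) {A B : Set S} (hA : MeasurableSet A)
    (hB : MeasurableSet B) :
    ∫ ω, (Z.clusterF i c ω : Measure S).real A * (Z.clusterF j c' ω : Measure S).real B ∂P =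
      (∫⁻ ω, H.innerMass (Z.ζ i c.1 ω) c A ω * H.innerMass (Z.ζ j c'.1 ω) c' B ω ∂P).toReal := by
  rw [integral_eq_lintegral_of_nonneg_ae
    (ae_of_all _ fun ω => mul_nonneg measureReal_nonneg measureReal_nonneg)
    ((Z.memLp_clusterF i c hA).aestronglyMeasurable.mul
      (Z.memLp_clusterF j c' hB).aestronglyMeasurable)]
  congr 1
  refine lintegral_congr_ae ?_
  filter_upwards [Z.clusterF_ae_eq i c hA, Z.clusterF_ae_eq j c' hB] with ω h1 h2
  rw [ENNReal.ofReal_mul measureReal_nonneg, ofReal_measureReal, ofReal_measureReal, h1, h2]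

/-- A quantity that depends on the inner random measures only has the same expectation for the
class of a cluster as for a fixed class. -/
lemma lintegral_class_of_indep (hKm : ∀ v, Measurable (K v))
    (hK : ∀ v g, K v g ∈ Set.Ioc (0 : ℝ) 1) (i : Fin n) (c : V × X)
    {Φ : ℕ → Ω → ℝ≥0∞} (hΦ : ∀ k, Measurable[H.sourceSigma (innerSources k)] (Φ k)) {y : ℝ≥0∞}
    (hy : ∀ k, ∫⁻ ω, Φ k ω ∂P = y) : ∫⁻ ω, Φ (Z.ζ i c.1 ω) ω ∂P = y := by
  have hm : ∀ k, Measurable[H.sourceSigma outerSources] fun ω =>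
      ENNReal.ofReal (H.clusterWeight k c.1 ω) :=
    fun k => (H.measurable_clusterWeight hKm k c.1).ennreal_ofReal
  rw [Z.lintegral_class hKm hK i c.1 fun k => (hΦ k).mono (H.sourceSigma_le_sigma _) le_rfl]
  simp_rw [fun k => H.lintegral_mul_of_disjoint (disjoint_innerSources_outerSources k).symm (hm k)
    (hΦ k), hy]
  rw [ENNReal.tsum_mul_right,
    ← lintegral_tsum fun k => ((hm k).mono (H.sourceSigma_le _) le_rfl).aemeasurable,
    lintegral_congr_ae (H.tsum_clusterWeight c)]
  simp

lemma integral_clusterF (hKm : ∀ v, Measurable (K v)) (hK : ∀ v g, K v g ∈ Set.Ioc (0 : ℝ) 1)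
    (i : Fin n) (c : V × X) {A : Set S} (hA : MeasurableSet A) :
    ∫ ω, (Z.clusterF i c ω : Measure S).real A ∂P = (G c : Measure S).real A := by
  rw [integral_eq_lintegral_of_nonneg_ae (ae_of_all _ fun ω => measureReal_nonneg)
    (Z.memLp_clusterF i c hA).aestronglyMeasurable, measureReal_def,
    ← Z.lintegral_class_of_indep hKm hK i c (fun k => H.measurable_innerMass k c hA)
      fun k => H.lintegral_innerMass k c hA]
  congr 1
  refine lintegral_congr_ae ?_
  filter_upwards [Z.clusterF_ae_eq i c hA] with ω h1
  rw [ofReal_measureReal, h1]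

theorem covariance_clusterF_self (hβ : 0 < β) (hKm : ∀ v, Measurable (K v))
    (hK : ∀ v g, K v g ∈ Set.Ioc (0 : ℝ) 1) (i : Fin n) (v : V) (x x' : X) {A B : Set S}
    (hA : MeasurableSet A) (hB : MeasurableSet B) :
    cov[fun ω => (Z.clusterF i (v, x) ω : Measure S).real A,
        fun ω => (Z.clusterF i (v, x') ω : Measure S).real B; P] =
      (P.real {ω | H.θ 0 0 (v, x) ω ∈ A ∧ H.θ 0 0 (v, x') ω ∈ B} -
        (G (v, x) : Measure S).real A * (G (v, x') : Measure S).real B) / (β + 1) := by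
  rw [covariance_eq_sub (Z.memLp_clusterF i _ hA) (Z.memLp_clusterF i _ hB),
    Z.integral_clusterF hKm hK i _ hA, Z.integral_clusterF hKm hK i _ hB]
  simp only [Pi.mul_apply]
  have h := Z.lintegral_class_of_indep hKm hK i (v, x)
    (Φ := fun k ω => H.innerMass k (v, x) A ω * H.innerMass k (v, x') B ω)
    (fun k => (H.measurable_innerMass k _ hA).fun_mul (H.measurable_innerMass k _ hB))
    fun k => H.lintegral_innerMass_mul_self_eq hβ k _ _ hA hB
  rw [Z.integral_clusterF_mul i i _ _ hA hB, h, ENNReal.toReal_ofReal]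
  · ring
  · have h1 : 0 ≤ (G (v, x) : Measure S).real A * (G (v, x') : Measure S).real B :=
      mul_nonneg measureReal_nonneg measureReal_nonneg
    have h2 : 0 ≤ P.real {ω | H.θ 0 0 (v, x) ω ∈ A ∧ H.θ 0 0 (v, x') ω ∈ B} := measureReal_nonneg
    have e : ∀ t r : ℝ, t + (r - t) / (β + 1) = (t * β + r) / (β + 1) := fun t r => by
      field_simp; ring
    rw [e]
    positivity

theorem variance_clusterF (hβ : 0 < β) (hKm : ∀ v, Measurable (K v))
    (hK : ∀ v g, K v g ∈ Set.Ioc (0 : ℝ) 1) (i : Fin n) (c : V × X) {A : Set S}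
    (hA : MeasurableSet A) :
    Var[fun ω => (Z.clusterF i c ω : Measure S).real A; P] =
      (G c : Measure S).real A * (1 - (G c : Measure S).real A) / (β + 1) := by
  rw [← covariance_self (Z.memLp_clusterF i c hA).aestronglyMeasurable.aemeasurable,
    show c = (c.1, c.2) from rfl, Z.covariance_clusterF_self hβ hKm hK i c.1 c.2 c.2 hA hA]
  have : P.real {ω | H.θ 0 0 (c.1, c.2) ω ∈ A ∧ H.θ 0 0 (c.1, c.2) ω ∈ A} =
      (G (c.1, c.2) : Measure S).real A := by
    simp only [and_self]
    rw [measureReal_def, measureReal_def, ← H.law_θ 0 0 (c.1, c.2),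
      Measure.map_apply (H.measurable_θ 0 0 _) hA]
    rfl
  rw [this]
  ring

/-- Two clusters with different classes contribute nothing to the covariance, and two clusters of a
common class, which has probability `E[h]`, as much as within one cluster. -/
theorem covariance_clusterF_of_ne (hα : 0 < α) (hβ : 0 < β) (hKm : ∀ v, Measurable (K v))
    (hK : ∀ v g, K v g ∈ Set.Ioc (0 : ℝ) 1) {i j : Fin n} (hij : i ≠ j) (c c' : V × X)
    {A B : Set S} (hA : MeasurableSet A) (hB : MeasurableSet B) :
    cov[fun ω => (Z.clusterF i c ω : Measure S).real A,
        fun ω => (Z.clusterF j c' ω : Measure S).real B; P] =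
      (∫ ω, hFactor α K c.1 c'.1 (fun m => H.Γ m ω) ∂P) *
        ((P.real {ω | H.θ 0 0 c ω ∈ A ∧ H.θ 0 0 c' ω ∈ B} -
          (G c : Measure S).real A * (G c' : Measure S).real B) / (β + 1)) := by
  rw [covariance_eq_sub (Z.memLp_clusterF i _ hA) (Z.memLp_clusterF j _ hB),
    Z.integral_clusterF hKm hK i _ hA, Z.integral_clusterF hKm hK j _ hB]
  simp only [Pi.mul_apply]
  have hm : ∀ (c : V × X) k, Measurable[H.sourceSigma outerSources] fun ω =>
      ENNReal.ofReal (H.clusterWeight k c.1 ω) :=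
    fun c k => (H.measurable_clusterWeight hKm k c.1).ennreal_ofReal
  have hm' : ∀ (c : V × X) k, Measurable fun ω => ENNReal.ofReal (H.clusterWeight k c.1 ω) :=
    fun c k => (hm c k).mono (H.sourceSigma_le _) le_rfl
  set a := (G c : Measure S).real A with ha
  set b := (G c' : Measure S).real B with hb
  set r : ℝ := a * b + (P.real {ω | H.θ 0 0 c ω ∈ A ∧ H.θ 0 0 c' ω ∈ B} - a * b) / (β + 1) with hr
  have hr0 : 0 ≤ r := by
    have h1 : 0 ≤ a * b := mul_nonneg measureReal_nonneg measureReal_nonneg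
    have h2 : 0 ≤ P.real {ω | H.θ 0 0 c ω ∈ A ∧ H.θ 0 0 c' ω ∈ B} := measureReal_nonneg
    have e : ∀ t r : ℝ, t + (r - t) / (β + 1) = (t * β + r) / (β + 1) := fun t r => by
      field_simp; ring
    rw [hr, e]
    positivity
  -- given the weights, the inner measures of the classes are uncorrelated unless they coincide
  have hX : ∫⁻ ω, H.innerMass (Z.ζ i c.1 ω) c A ω * H.innerMass (Z.ζ j c'.1 ω) c' B ω ∂P =
      ∑' k, ∑' m, (∫⁻ ω, ENNReal.ofReal (H.clusterWeight k c.1 ω) *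
        ENNReal.ofReal (H.clusterWeight m c'.1 ω) ∂P) *
        (if k = m then ENNReal.ofReal r else (G c : Measure S) A * (G c' : Measure S) B) := by
    rw [Z.lintegral_class_class hKm hK hij c.1 c'.1
      (Φ := fun k m ω => H.innerMass k c A ω * H.innerMass m c' B ω) fun k m =>
        ((H.measurable_innerMass k c hA).mono (H.sourceSigma_le_sigma _) le_rfl).fun_mul
        ((H.measurable_innerMass m c' hB).mono (H.sourceSigma_le_sigma _) le_rfl)]
    refine tsum_congr fun k => tsum_congr fun m => ?_
    have hd : Disjoint outerSources (innerSources k ∪ innerSources m) :=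
      Set.disjoint_union_right.2 ⟨(disjoint_innerSources_outerSources k).symm,
        (disjoint_innerSources_outerSources m).symm⟩
    rw [H.lintegral_mul_of_disjoint hd ((hm c k).fun_mul (hm c' m))
      (((H.measurable_innerMass k c hA).mono (H.sourceSigma_mono Set.subset_union_left)
        le_rfl).fun_mul ((H.measurable_innerMass m c' hB).mono
          (H.sourceSigma_mono Set.subset_union_right) le_rfl))]
    split_ifs with hkm
    · subst hkm
      rw [H.lintegral_innerMass_mul_self_eq hβ k c c' hA hB]
    · rw [H.lintegral_innerMass_mul_of_ne hkm c c' hA hB]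
  have hsum := tsum_tsum_lintegral_mul (hm' c) (hm' c') (H.tsum_clusterWeight c)
    (H.tsum_clusterWeight c')
  have key := ENNReal.tsum_tsum_mul_ite_add hsum (ENNReal.ofReal r)
    ((G c : Measure S) A * (G c' : Measure S) B)
  have hD : ∑' k, ∫⁻ ω, ENNReal.ofReal (H.clusterWeight k c.1 ω) *
      ENNReal.ofReal (H.clusterWeight k c'.1 ω) ∂P ≠ ∞ := by
    refine ne_top_of_le_ne_top ENNReal.one_ne_top (hsum ▸ ENNReal.tsum_le_tsum fun k => ?_)
    exact ENNReal.le_tsum (f := fun m => ∫⁻ ω, ENNReal.ofReal (H.clusterWeight k c.1 ω) *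
      ENNReal.ofReal (H.clusterWeight m c'.1 ω) ∂P) k
  have hDint : (∑' k, ∫⁻ ω, ENNReal.ofReal (H.clusterWeight k c.1 ω) *
      ENNReal.ofReal (H.clusterWeight k c'.1 ω) ∂P).toReal =
      ∫ ω, hFactor α K c.1 c'.1 (fun m => H.Γ m ω) ∂P := by
    rw [H.tsum_lintegral_clusterWeight_mul hα hKm hK, integral_eq_lintegral_of_nonneg_ae
      (ae_of_all _ fun ω => hFactor_nonneg hα hK _ _ _)
      (H.measurable_hFactor_Γ hKm _ _).aestronglyMeasurable]
  rw [Z.integral_clusterF_mul i j c c' hA hB, hX, toReal_eq_of_add_eq hD ENNReal.ofReal_ne_top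
    (ENNReal.mul_ne_top (measure_ne_top _ _) (measure_ne_top _ _)) key, hDint,
    ENNReal.toReal_ofReal hr0, ENNReal.toReal_mul, ← measureReal_def, ← measureReal_def]
  rw [hr]
  ring

theorem corr_clusterF_self (hβ : 0 < β) (hKm : ∀ v, Measurable (K v))
    (hK : ∀ v g, K v g ∈ Set.Ioc (0 : ℝ) 1) (i : Fin n) (v : V) (x x' : X) {A B : Set S}
    (hA : MeasurableSet A) (hB : MeasurableSet B) (l k : ℕ) :
    corr (fun ω => (Z.clusterF i (v, x) ω : Measure S).real A)
        (fun ω => (Z.clusterF i (v, x') ω : Measure S).real B) P =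
      corrRatio (P.real {ω | H.θ l k (v, x) ω ∈ A ∧ H.θ l k (v, x') ω ∈ B})
        ((G (v, x) : Measure S).real A) ((G (v, x') : Measure S).real B) := by
  rw [measureReal_def, H.measure_θ_pair_eq l k 0 0 _ _ hA hB, ← measureReal_def,
    corr_eq_mul_corrRatio hβ (h := 1)
      (by rw [one_mul, Z.covariance_clusterF_self hβ hKm hK i v x x' hA hB])
      (Z.variance_clusterF hβ hKm hK i _ hA) (Z.variance_clusterF hβ hKm hK i _ hB), one_mul]

theorem corr_clusterF_of_ne (hα : 0 < α) (hβ : 0 < β) (hKm : ∀ v, Measurable (K v))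
    (hK : ∀ v g, K v g ∈ Set.Ioc (0 : ℝ) 1) {i j : Fin n} (hij : i ≠ j) (c c' : V × X)
    {A B : Set S} (hA : MeasurableSet A) (hB : MeasurableSet B) (l k : ℕ) :
    corr (fun ω => (Z.clusterF i c ω : Measure S).real A)
        (fun ω => (Z.clusterF j c' ω : Measure S).real B) P =
      (∫ ω, hFactor α K c.1 c'.1 (fun m => H.Γ m ω) ∂P) *
        corrRatio (P.real {ω | H.θ l k c ω ∈ A ∧ H.θ l k c' ω ∈ B})
          ((G c : Measure S).real A) ((G c' : Measure S).real B) := by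
  rw [measureReal_def (s := {ω | H.θ l k c ω ∈ A ∧ H.θ l k c' ω ∈ B}),
    H.measure_θ_pair_eq l k 0 0 _ _ hA hB, ← measureReal_def]
  exact corr_eq_mul_corrRatio hβ (Z.covariance_clusterF_of_ne hα hβ hKm hK hij c c' hA hB)
    (Z.variance_clusterF hβ hKm hK i _ hA) (Z.variance_clusterF hβ hKm hK j _ hB)

end Allocation

end FDnDDP

/-! ### Weak neighbourhoods and mixtures of probability measures -/

section Weak

variable {C E : Type*} [TopologicalSpace E] [MeasurableSpace E]

/-- A point outside a closed set of families of probability measures is separated from it by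
finitely many integrals of bounded continuous functions. -/
lemma exists_finset_integral_of_notMem [OpensMeasurableSpace E]
    {D : Set (C → ProbabilityMeasure E)} (hD : IsClosed D)
    {Q : C → ProbabilityMeasure E} (hQ : Q ∉ D) :
    ∃ (T : Finset (C × BoundedContinuousFunction E ℝ)) (ε : ℝ), 0 < ε ∧
      ∀ R : C → ProbabilityMeasure E,
        (∀ p ∈ T, |∫ x, p.2 x ∂(R p.1 : Measure E) - ∫ x, p.2 x ∂(Q p.1 : Measure E)| < ε) →
        R ∉ D := by
  set emb : (C → ProbabilityMeasure E) → C × BoundedContinuousFunction E ℝ → ℝ :=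
    fun R p => ∫ x, p.2 x ∂(R p.1 : Measure E) with hemb
  have hle : comap emb (𝓝 (emb Q)) ≤ 𝓝 Q := by
    rw [nhds_pi (a := Q), Filter.pi]
    refine le_iInf fun c => tendsto_iff_comap.1 ?_
    refine ProbabilityMeasure.tendsto_iff_forall_integral_tendsto.2 fun f => ?_
    exact (tendsto_pi_nhds.1 (tendsto_comap (f := emb) (x := 𝓝 (emb Q)))) (c, f)
  obtain ⟨t, ht, htD⟩ := hle (hD.isOpen_compl.mem_nhds hQ)
  rw [nhds_pi, Filter.mem_pi] at ht
  obtain ⟨s, hs, t', ht', hsub⟩ := ht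
  have hev : ∀ᶠ ε in 𝓝[>] (0 : ℝ), ∀ p ∈ s, Metric.ball (emb Q p) ε ⊆ t' p := by
    rw [Filter.eventually_all_finite hs]
    intro p _
    obtain ⟨ε, hε, hball⟩ := Metric.mem_nhds_iff.1 (ht' p)
    filter_upwards [Ioo_mem_nhdsGT hε] with δ hδ
    exact (Metric.ball_subset_ball hδ.2.le).trans hball
  obtain ⟨ε, hε, hε0⟩ := (hev.and self_mem_nhdsWithin).exists
  refine ⟨hs.toFinset, ε, hε0, fun R hR => htD (hsub fun p hp => hε p hp ?_)⟩
  exact hR p (hs.mem_toFinset.2 hp)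

lemma isClosed_setOf_measure_eq_one [OpensMeasurableSpace E] [HasOuterApproxClosed E] {Θ : Set E}
    (hΘ : IsClosed Θ) : IsClosed {Q : ProbabilityMeasure E | (Q : Measure E) Θ = 1} := by
  rw [isClosed_iff_clusterPt]
  intro Q hQ
  have hne : (𝓝 Q ⊓ 𝓟 {Q : ProbabilityMeasure E | (Q : Measure E) Θ = 1}).NeBot := hQ
  have hlim := ProbabilityMeasure.limsup_measure_closed_le_of_tendsto
    (μs := fun R : ProbabilityMeasure E => R) (μ := Q)
    (L := 𝓝 Q ⊓ 𝓟 {Q : ProbabilityMeasure E | (Q : Measure E) Θ = 1})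
    (tendsto_id.mono_left inf_le_left) hΘ
  have h1 : limsup (fun R : ProbabilityMeasure E => (R : Measure E) Θ)
      (𝓝 Q ⊓ 𝓟 {Q : ProbabilityMeasure E | (Q : Measure E) Θ = 1}) = 1 := by
    rw [limsup_congr (v := fun _ => 1) (mem_inf_of_right (mem_principal_self _)), limsup_const]
  exact le_antisymm prob_le_one (h1 ▸ hlim)

end Weak

/-- The integral of a bounded function against a countable mixture, up to the mass of the
components left out. -/
lemma abs_integral_sub_sum_le {E : Type*} [MeasurableSpace E] {μ : Measure E}
    [IsProbabilityMeasure μ] {ν : ℕ → Measure E} [∀ k, IsProbabilityMeasure (ν k)] {c : ℕ → ℝ}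
    (hc : ∀ k, 0 ≤ c k) (hμ : μ = Measure.sum fun k => ENNReal.ofReal (c k) • ν k) {f : E → ℝ}
    {M : ℝ} (hf : Measurable f) (hM : ∀ x, |f x| ≤ M) (N : ℕ) :
    |∫ x, f x ∂μ - ∑ k ∈ Finset.range N, c k * ∫ x, f x ∂(ν k)| ≤
      M * (1 - ∑ k ∈ Finset.range N, c k) := by
  have hi : ∀ (μ : Measure E) [IsProbabilityMeasure μ], Integrable f μ := fun μ _ =>
    Integrable.of_bound hf.aestronglyMeasurable M (ae_of_all _ hM)
  have hsum : ∀ g : E → ℝ, Integrable g μ →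
      HasSum (fun k => c k * ∫ x, g x ∂(ν k)) (∫ x, g x ∂μ) := by
    intro g hg
    have := hasSum_integral_measure (μ := fun k => ENNReal.ofReal (c k) • ν k) (f := g) (hμ ▸ hg)
    rw [← hμ] at this
    simpa [integral_smul_measure, ENNReal.toReal_ofReal (hc _)] using this
  have h1 : HasSum c 1 := by simpa using hsum (fun _ => 1) (integrable_const _)
  have hf' := hsum f (hi μ)
  have hb : ∀ k, |∫ x, f x ∂(ν k)| ≤ M := fun k => by
    have := norm_integral_le_of_norm_le_const (μ := ν k) (f := f) (C := M) (ae_of_all _ hM)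
    simpa using this
  rw [abs_le]
  constructor
  · have h := sum_le_hasSum (Finset.range N) (fun k _ => ?_) ((h1.mul_left M).add hf')
    · rw [Finset.sum_add_distrib, ← Finset.mul_sum] at h
      linarith
    · nlinarith [hc k, (abs_le.1 (hb k)).1]
  · have h := sum_le_hasSum (Finset.range N) (fun k _ => ?_) ((h1.mul_left M).sub hf')
    · rw [Finset.sum_sub_distrib, ← Finset.mul_sum] at h
      linarith
    · nlinarith [hc k, (abs_le.1 (hb k)).2]

/-! ### Positive copulas charge all products of relatively open sets -/

/-- The box with upper corner `b` whose sides with labels in `A` are bounded below by `a`. -/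
def lowerUpperBox {ι E : Type*} [Preorder E] (A : Finset ι) (a b : ι → E) : Set (ι → E) :=
  {x | ∀ p, x p ≤ b p ∧ (p ∈ A → a p < x p)}

section Box

variable {ι : Type*} [Finite ι]

lemma measurableSet_lowerUpperBox {E : Type*} [LinearOrder E] [TopologicalSpace E]
    [OrderClosedTopology E] [MeasurableSpace E] [OpensMeasurableSpace E] [SecondCountableTopology E]
    (A : Finset ι) (a b : ι → E) : MeasurableSet (lowerUpperBox A a b) := by
  have : lowerUpperBox A a b = ⋂ p, {x | x p ≤ b p} ∩ {x | p ∈ A → a p < x p} := by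
    ext x; simp [lowerUpperBox]
  rw [this]
  refine MeasurableSet.iInter fun p => ?_
  refine (measurableSet_le (measurable_pi_apply p) measurable_const).inter ?_
  by_cases hp : p ∈ A
  · simpa [hp] using measurableSet_lt measurable_const (measurable_pi_apply p)
  · simp [hp]

/-- Adding one lower bound is a difference of two boxes with fewer lower bounds. -/
lemma measureReal_lowerUpperBox_insert [DecidableEq ι] {E : Type*} [LinearOrder E]
    [TopologicalSpace E]
    [OrderClosedTopology E] [MeasurableSpace E] [OpensMeasurableSpace E] [SecondCountableTopology E]
    (μ : Measure (ι → E)) [IsFiniteMeasure μ] {A : Finset ι} {p : ι} (hp : p ∉ A) {a b : ι → E}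
    (hab : a p ≤ b p) :
    μ.real (lowerUpperBox (insert p A) a b) =
      μ.real (lowerUpperBox A a b) - μ.real (lowerUpperBox A a (Function.update b p (a p))) := by
  have hsub : lowerUpperBox A a (Function.update b p (a p)) ⊆ lowerUpperBox A a b := by
    intro x hx r
    refine ⟨?_, (hx r).2⟩
    have := (hx r).1
    by_cases h : r = p
    · subst h; rw [Function.update_self] at this; exact this.trans hab
    · rwa [Function.update_of_ne h] at this
  rw [← measureReal_sdiff hsub (measurableSet_lowerUpperBox _ _ _)]
  congr 1
  ext x
  simp only [lowerUpperBox, Set.mem_ofPred_eq, Set.mem_sdiff, Finset.mem_insert]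
  constructor
  · intro h
    refine ⟨fun r => ⟨(h r).1, fun hr => (h r).2 (.inr hr)⟩, fun h' => ?_⟩
    have := (h' p).1
    rw [Function.update_self] at this
    exact this.not_gt ((h p).2 (.inl rfl))
  · rintro ⟨h, h'⟩ r
    refine ⟨(h r).1, ?_⟩
    rintro (rfl | hr)
    · by_contra hlt
      refine h' fun r' => ⟨?_, (h r').2⟩
      by_cases hr' : r' = r
      · subst hr'; rw [Function.update_self]; exact not_lt.1 hlt
      · rw [Function.update_of_ne hr']; exact (h r').1
    · exact (h r).2 hr

/-- If the distribution function of `μ` is that of `ν` composed with marginal distribution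
functions `F`, then boxes correspond to boxes, by inclusion and exclusion. -/
lemma measureReal_lowerUpperBox_eq [DecidableEq ι] {μ : Measure (ι → ℝ)} [IsFiniteMeasure μ]
    {ν : Measure (ι → I)} [IsFiniteMeasure ν] {F : ι → ℝ → I} (hF : ∀ p, Monotone (F p))
    (h : ∀ t : ι → ℝ, μ.real (Set.Iic t) = ν.real (Set.Iic fun p => F p (t p))) (A : Finset ι)
    (a b : ι → ℝ) (hab : ∀ p, a p ≤ b p) :
    μ.real (lowerUpperBox A a b) =
      ν.real (lowerUpperBox A (fun p => F p (a p)) (fun p => F p (b p))) := by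
  induction A using Finset.induction_on generalizing b with
  | empty =>
    have e : ∀ {E : Type} [Preorder E] (a b : ι → E), lowerUpperBox ∅ a b = Set.Iic b := by
      intro E _ a b; ext x; simp [lowerUpperBox, Pi.le_def]
    rw [e, e, h]
  | insert p A hp ih =>
    rw [measureReal_lowerUpperBox_insert μ hp (hab p), measureReal_lowerUpperBox_insert ν hp
      (hF p (hab p)), ih b hab, ih (Function.update b p (a p)) fun r => ?_]
    · congr 3
      ext1 r
      by_cases hr : r = p
      · subst hr; simp
      · simp [hr]
    · by_cases hr : r = p
      · subst hr; simp
      · simpa [hr] using hab r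

end Box

lemma monotone_coordCdf {q : ℕ} {S : Set (Fin q → ℝ)} (G : ProbabilityMeasure S) (m : Fin q) :
    Monotone (coordCdf G m) := fun _ _ hst =>
  Subtype.mk_le_mk.2 (measureReal_mono fun _ hx => le_trans hx hst)

lemma Copula.HasPositiveDensity.volume_absolutelyContinuous {ι : Type*} [Fintype ι] {ψ : Copula ι}
    (hψ : ψ.HasPositiveDensity) : (volume : Measure (ι → I)) ≪ (ψ.law : Measure (ι → I)) := by
  obtain ⟨f, hf, hpos, hlaw⟩ := hψ
  rw [hlaw]
  exact withDensity_absolutelyContinuous' hf.aemeasurable (hpos.mono fun _ h => h.ne')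

namespace FDnDDP

variable {Ω : Type*} [MeasurableSpace Ω] {P : Measure Ω} {V X Loc : Type*}
  [MeasurableSpace Loc] {q : ℕ} {S : Set (Fin q → ℝ)} {α β : ℝ} {K : V → Loc → ℝ}
  {Ψ : CopulaFamily ((V × X) × Fin q)} {G : V × X → ProbabilityMeasure S}

/-- An open box around points of the supports has sides that are charged by the marginals, so the
copula transform turns it into a box of positive volume. -/
theorem measure_θ_mem_pos [IsProbabilityMeasure P] (H : FDnDDP P α β K Ψ G)
    (hΨ : ∀ J, (Ψ.copula J).HasPositiveDensity)
    (l k : ℕ) (J : Finset (V × X)) {U : V × X → Set S} (hU : ∀ c ∈ J, IsOpen (U c))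
    (hne : ∀ c ∈ J, (U c ∩ (G c : Measure S).support).Nonempty) :
    0 < P {ω | ∀ c ∈ J, H.θ l k c ω ∈ U c} := by
  classical
  have hball : ∀ c, ∃ x : S, ∃ r > 0, c ∈ J →
      x ∈ (G c : Measure S).support ∧ Metric.ball x r ⊆ U c := by
    intro c
    by_cases hc : c ∈ J
    · obtain ⟨x, hxU, hx⟩ := hne c hc
      obtain ⟨r, hr, hsub⟩ := Metric.isOpen_iff.1 (hU c hc) x hxU
      exact ⟨x, r, hr, fun _ => ⟨hx, hsub⟩⟩
    · have : Nonempty S := (G c).nonempty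
      exact ⟨Classical.arbitrary S, 1, one_pos, fun h => absurd h hc⟩
  choose x r hr hx using hball
  set J' : Finset ((V × X) × Fin q) := J ×ˢ Finset.univ with hJ'
  set Y : Ω → J' → ℝ := fun ω p => (H.θ l k p.1.1 ω).1 p.1.2 with hY
  have hYm : Measurable Y := measurable_pi_iff.2 fun p =>
    (measurable_pi_apply p.1.2).comp (measurable_subtype_coe.comp (H.measurable_θ l k p.1.1))
  have : IsProbabilityMeasure (P.map Y) := Measure.isProbabilityMeasure_map hYm.aemeasurable
  set a : J' → ℝ := fun p => (x p.1.1).1 p.1.2 - r p.1.1 / 2 with ha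
  set b : J' → ℝ := fun p => (x p.1.1).1 p.1.2 + r p.1.1 / 2 with hb
  have hab : ∀ p, a p ≤ b p := fun p => by simp only [ha, hb]; linarith [hr p.1.1]
  have hcdf : ∀ t : J' → ℝ, (P.map Y).real (Set.Iic t) =
      ((Ψ.copula J').law : Measure (J' → I)).real
        (Set.Iic fun p => coordCdf (G p.1.1) p.1.2 (t p)) := by
    intro t
    rw [map_measureReal_apply hYm measurableSet_Iic]
    exact H.fdd_θ l k J' t
  have hbox := measureReal_lowerUpperBox_eq (fun p : J' => monotone_coordCdf (G p.1.1) p.1.2) hcdf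
    Finset.univ a b hab
  have hlt : ∀ p : J', coordCdf (G p.1.1) p.1.2 (a p) < coordCdf (G p.1.1) p.1.2 (b p) := by
    intro p
    have hpJ : p.1.1 ∈ J := (Finset.mem_product.1 p.2).1
    have hm : ∀ t : ℝ, MeasurableSet {y : S | y.1 p.1.2 ≤ t} := fun t =>
      measurableSet_le ((measurable_pi_apply p.1.2).comp measurable_subtype_coe) measurable_const
    have hpos : 0 < (G p.1.1 : Measure S).real (Metric.ball (x p.1.1) (r p.1.1 / 2)) :=
      ENNReal.toReal_pos ((Measure.mem_support_iff_forall _).1 (hx _ hpJ).1 _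
        (Metric.ball_mem_nhds _ (half_pos (hr _)))).ne' (measure_ne_top _ _)
    have hdiff := measureReal_sdiff (μ := (G p.1.1 : Measure S))
      (s₁ := {y : S | y.1 p.1.2 ≤ b p}) (s₂ := {y : S | y.1 p.1.2 ≤ a p})
      (fun y hy => le_trans (Set.mem_ofPred.1 hy) (hab p)) (hm _)
    have hmono : (G p.1.1 : Measure S).real (Metric.ball (x p.1.1) (r p.1.1 / 2)) ≤
        (G p.1.1 : Measure S).real ({y : S | y.1 p.1.2 ≤ b p} \ {y : S | y.1 p.1.2 ≤ a p}) := by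
      refine measureReal_mono fun y hy => ?_
      have h1 : dist (y.1 p.1.2) ((x p.1.1).1 p.1.2) < r p.1.1 / 2 :=
        (dist_le_pi_dist y.1 (x p.1.1).1 p.1.2).trans_lt hy
      rw [Real.dist_eq, abs_lt] at h1
      refine ⟨?_, ?_⟩
      · show y.1 p.1.2 ≤ b p
        simp only [hb]; linarith
      · show ¬ y.1 p.1.2 ≤ a p
        simp only [ha]; linarith
    rw [← Subtype.coe_lt_coe]
    simp only [coordCdf]
    linarith
  have hpos : 0 < ((Ψ.copula J').law : Measure (J' → I)) (lowerUpperBox Finset.univ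
      (fun p => coordCdf (G p.1.1) p.1.2 (a p)) (fun p => coordCdf (G p.1.1) p.1.2 (b p))) := by
    rw [pos_iff_ne_zero]
    intro h0
    have h1 := (hΨ J').volume_absolutelyContinuous h0
    have h2 : lowerUpperBox Finset.univ (fun p : J' => coordCdf (G p.1.1) p.1.2 (a p))
        (fun p => coordCdf (G p.1.1) p.1.2 (b p)) = Set.pi Set.univ fun p : J' =>
          Set.Ioc (coordCdf (G p.1.1) p.1.2 (a p)) (coordCdf (G p.1.1) p.1.2 (b p)) := by
      ext y
      exact ⟨fun h p _ => ⟨(h p).2 (Finset.mem_univ p), (h p).1⟩,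
        fun h p => ⟨(h p trivial).2, fun _ => (h p trivial).1⟩⟩
    rw [h2, volume_pi_pi, Finset.prod_eq_zero_iff] at h1
    obtain ⟨p, -, hp⟩ := h1
    rw [unitInterval.volume_Ioc, ENNReal.ofReal_eq_zero] at hp
    exact absurd hp (not_le.2 (sub_pos.2 (hlt p)))
  have hPpos : 0 < P (Y ⁻¹' lowerUpperBox Finset.univ a b) := by
    rw [← Measure.map_apply hYm (measurableSet_lowerUpperBox _ _ _)]
    have : 0 < (P.map Y).real (lowerUpperBox Finset.univ a b) := by
      rw [hbox]; exact ENNReal.toReal_pos hpos.ne' (measure_ne_top _ _)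
    exact (ENNReal.toReal_pos_iff.1 this).1
  refine hPpos.trans_le (measure_mono fun ω hω c hc => (hx c hc).2 ?_)
  rw [Metric.mem_ball, Subtype.dist_eq]
  refine lt_of_le_of_lt ((dist_pi_le_iff (half_pos (hr c)).le).2 fun m => ?_)
    (half_lt_self (hr c))
  have := hω ⟨(c, m), by simp [hJ', hc]⟩
  simp only [hY, ha, hb, Finset.mem_univ, forall_const] at this
  rw [Real.dist_eq, abs_le]
  exact ⟨by linarith [this.2], by linarith [this.1]⟩

end FDnDDP

/-! ### Stick-breaking approximation of families of probability measures -/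

section Approximation

variable {C E : Type*} [TopologicalSpace E] [MeasurableSpace E] [OpensMeasurableSpace E]

/-- Finitely many integrals against probability measures on `Θ` are approximated simultaneously by
a stick-breaking mixture of point masses, with weights common to all measures: the vector of
integrals is a mean over the product measure, so it lies in the closed convex hull of the vectors
of values at points of `Θ`. -/
lemma exists_stickBreak_approx {Q : C → ProbabilityMeasure E} {Θ : Set E} (hΘ : MeasurableSet Θ)
    (hQ : ∀ c, (Q c : Measure E) Θ = 1) (T : Finset (C × BoundedContinuousFunction E ℝ)) {ε : ℝ}
    (hε : 0 < ε) :
    ∃ (N : ℕ) (b : ℕ → ℝ) (x : ℕ → C → E), (∀ i, b i ∈ Set.Icc (0 : ℝ) 1) ∧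
      (∀ l c, x l c ∈ Θ) ∧ ∏ i ∈ Finset.range N, (1 - b i) = 0 ∧
      ∀ p ∈ T, |∑ l ∈ Finset.range N, stickBreak b l * p.2 (x l p.1) -
        ∫ y, p.2 y ∂(Q p.1 : Measure E)| < ε := by
  classical
  have hΘne : Nonempty (C → Θ) := by
    refine ⟨fun c => Classical.choice (Set.Nonempty.to_subtype ?_)⟩
    by_contra h
    have := hQ c
    rw [Set.not_nonempty_iff_eq_empty.1 h, measure_empty] at this
    exact zero_ne_one this
  obtain ⟨x₀⟩ := hΘne
  set μ : Measure (C → E) := Measure.infinitePi fun c => (Q c : Measure E) with hμ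
  set Φ : (C → E) → T → ℝ := fun x p => p.1.2 (x p.1.1) with hΦ
  have hΦm : ∀ p : T, Measurable fun x => Φ x p := fun p =>
    p.1.2.continuous.measurable.comp (measurable_pi_apply p.1.1)
  have hΦi : ∀ p : T, Integrable (fun x => Φ x p) μ := fun p =>
    Integrable.of_bound (hΦm p).aestronglyMeasurable ‖p.1.2‖
      (ae_of_all _ fun x => p.1.2.norm_coe_le_norm _)
  have hmp : ∀ c, MeasurePreserving (Function.eval c) μ (Q c : Measure E) := fun c =>
    measurePreserving_eval_infinitePi (fun c => (Q c : Measure E)) c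
  have hmean : ∀ p : T, (∫ x, Φ x ∂μ) p = ∫ y, p.1.2 y ∂(Q p.1.1 : Measure E) := by
    intro p
    rw [eval_integral hΦi, ← (hmp p.1.1).map_eq, integral_map (hmp p.1.1).measurable.aemeasurable
      p.1.2.continuous.measurable.aestronglyMeasurable]
  have hae : ∀ᵐ x ∂μ, Φ x ∈ closure (convexHull ℝ (Φ '' {x | ∀ c, x c ∈ Θ})) := by
    have h : ∀ᵐ x ∂μ, ∀ p : T, x p.1.1 ∈ Θ := by
      refine ae_all_iff.2 fun p => ?_
      have : ∀ᵐ y ∂(Q p.1.1 : Measure E), y ∈ Θ :=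
        (mem_ae_iff_prob_eq_one hΘ).2 (hQ p.1.1)
      exact (hmp p.1.1).quasiMeasurePreserving.ae this
    filter_upwards [h] with x hx
    refine subset_closure (subset_convexHull ℝ _
      ⟨fun c => if x c ∈ Θ then x c else x₀ c, fun c => ?_, ?_⟩)
    · by_cases hc : x c ∈ Θ <;> simp [hc]
    · ext p
      simp [hΦ, hx p]
  have hmem := (convex_convexHull ℝ (Φ '' {x | ∀ c, x c ∈ Θ})).closure.integral_mem
    isClosed_closure hae (Integrable.of_eval hΦi)
  obtain ⟨z, hz, hdist⟩ := Metric.mem_closure_iff.1 hmem ε hε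
  obtain ⟨ι, _, w, y, hw0, hw1, hy, hzsum⟩ := mem_convexHull_iff_exists_fintype.1 hz
  choose x hxΘ hxy using hy
  set N := Fintype.card ι
  set e := Fintype.equivFin ι
  have hsum : ∀ g : ι → ℝ, ∑ l ∈ Finset.range N, (if h : l < N then g (e.symm ⟨l, h⟩) else 0) =
      ∑ i, g i := by
    intro g
    rw [Finset.sum_range, ← e.symm.sum_comp]
    exact Finset.sum_congr rfl fun l _ => by simp
  obtain ⟨b, hb, hbp, hprod⟩ := exists_stickBreak_eq
    (p := fun l => if h : l < N then w (e.symm ⟨l, h⟩) else 0) (N := N)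
    (fun l => by split_ifs; exacts [hw0 _, le_rfl]) (fun l hl => dif_neg (not_lt.2 hl))
    ((hsum w).trans hw1)
  refine ⟨N, b, fun l c => if h : l < N then x (e.symm ⟨l, h⟩) c else x₀ c, hb, fun l c => ?_,
    hprod, fun p hp => ?_⟩
  · dsimp only
    split_ifs with h
    exacts [hxΘ _ c, (x₀ c).2]
  · have h1 : ∑ l ∈ Finset.range N, stickBreak b l *
        p.2 (if h : l < N then x (e.symm ⟨l, h⟩) p.1 else x₀ p.1) = z ⟨p, hp⟩ := by
      rw [← hzsum, Finset.sum_apply, ← hsum]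
      refine Finset.sum_congr rfl fun l hl => ?_
      have hl' := Finset.mem_range.1 hl
      rw [hbp]
      simp [hl', ← hxy, hΦ]
    rw [h1, ← hmean ⟨p, hp⟩, abs_sub_comm, ← Real.dist_eq]
    exact (dist_le_pi_dist _ _ _).trans_lt hdist

/-- The approximation persists for sticks and atoms in suitable open sets. -/
lemma exists_isOpen_stickBreak_approx {Q : C → ProbabilityMeasure E} {Θ : Set E}
    (hΘ : MeasurableSet Θ) (hQ : ∀ c, (Q c : Measure E) Θ = 1)
    (T : Finset (C × BoundedContinuousFunction E ℝ)) {ε : ℝ} (hε : 0 < ε) :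
    ∃ (N : ℕ) (s₁ : Finset ℕ) (U : ℕ → Set ℝ) (s₂ : Finset (ℕ × C)) (W : ℕ × C → Set E),
      (∀ i, IsOpen (U i)) ∧ (∀ i, (U i ∩ Set.Icc 0 1).Nonempty) ∧ (∀ j, IsOpen (W j)) ∧
      (∀ j, (W j ∩ Θ).Nonempty) ∧
      ∀ (u : ℕ → ℝ) (y : ℕ × C → E), (∀ i ∈ s₁, u i ∈ U i) → (∀ j ∈ s₂, y j ∈ W j) →
        ∏ i ∈ Finset.range N, (1 - u i) < ε ∧
        ∀ p ∈ T, |∑ l ∈ Finset.range N, stickBreak u l * p.2 (y (l, p.1)) -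
          ∫ z, p.2 z ∂(Q p.1 : Measure E)| < ε := by
  obtain ⟨N, b, x, hb, hx, hprod, happ⟩ := exists_stickBreak_approx hΘ hQ T hε
  have hsb : ∀ l, Continuous fun q : (ℕ → ℝ) × (ℕ × C → E) => stickBreak q.1 l := fun l => by
    unfold stickBreak; fun_prop
  have hc : ∀ p : C × BoundedContinuousFunction E ℝ, Continuous fun q : (ℕ → ℝ) × (ℕ × C → E) =>
      |∑ l ∈ Finset.range N, stickBreak q.1 l * p.2 (q.2 (l, p.1)) -
        ∫ z, p.2 z ∂(Q p.1 : Measure E)| := fun p =>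
    ((continuous_finsetSum _ fun l _ => (hsb l).mul (p.2.continuous.comp
      ((continuous_apply (l, p.1)).comp continuous_snd))).sub continuous_const).abs
  have hc' : Continuous fun q : (ℕ → ℝ) × (ℕ × C → E) => ∏ i ∈ Finset.range N, (1 - q.1 i) := by
    fun_prop
  have hev : ∀ᶠ q in 𝓝 (b, fun j : ℕ × C => x j.1 j.2), ∏ i ∈ Finset.range N, (1 - q.1 i) < ε ∧
      ∀ p ∈ T, |∑ l ∈ Finset.range N, stickBreak q.1 l * p.2 (q.2 (l, p.1)) -
        ∫ z, p.2 z ∂(Q p.1 : Measure E)| < ε := by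
    refine ((hc'.tendsto _).eventually_lt_const (by simpa [hprod] using hε)).and ?_
    rw [Filter.eventually_all_finset]
    exact fun p hp => ((hc p).tendsto _).eventually_lt_const (happ p hp)
  rw [nhds_prod_eq, nhds_pi, nhds_pi, Filter.eventually_prod_iff] at hev
  obtain ⟨p₁, h₁, p₂, h₂, h⟩ := hev
  obtain ⟨I₁, hI₁, t₁, ht₁, hs₁⟩ := Filter.mem_pi.1 h₁
  obtain ⟨I₂, hI₂, t₂, ht₂, hs₂⟩ := Filter.mem_pi.1 h₂
  refine ⟨N, hI₁.toFinset, fun i => interior (t₁ i), hI₂.toFinset, fun j => interior (t₂ j),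
    fun i => isOpen_interior, fun i => ⟨b i, mem_interior_iff_mem_nhds.2 (ht₁ i), hb i⟩,
    fun j => isOpen_interior, fun j => ⟨x j.1 j.2, mem_interior_iff_mem_nhds.2 (ht₂ j), hx _ _⟩,
    fun u y hu hy => ?_⟩
  exact h (x := u) (hs₁ fun i hi => interior_subset (hu i (hI₁.mem_toFinset.2 hi)))
    (y := y) (hs₂ fun j hj => interior_subset (hy j (hI₂.mem_toFinset.2 hj)))

end Approximation

/-! ### Full weak support -/

lemma measurable_indicator_one {Ω : Type*} {m : MeasurableSpace Ω} {A : Set Ω}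
    (hA : MeasurableSet A) : Measurable (A.indicator (1 : Ω → ℝ≥0∞)) :=
  measurable_one.indicator hA

/-- Criterion for full weak support: the process is concentrated on the closed set `Θ`, and visits
every weak neighbourhood, given by finitely many integrals, of a family concentrated on `Θ` with
positive probability. An element of `C` is supplied, as there is nothing to show for empty `C`. -/
lemma hasFullWeakSupport_of_forall {Ω C E : Type*} [MeasurableSpace Ω] {P : Measure Ω}
    [IsProbabilityMeasure P] [TopologicalSpace E] [MeasurableSpace E] [OpensMeasurableSpace E]
    [HasOuterApproxClosed E] {F : C → Ω → ProbabilityMeasure E} {Θ : Set E}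
    (hΘ : C → IsClosed Θ) (hconc : ∀ c, ∀ᵐ ω ∂P, (F c ω : Measure E) Θ = 1)
    (hvisit : ∀ Q ∈ concentratedOn C Θ, ∀ (T : Finset (C × BoundedContinuousFunction E ℝ)) (ε : ℝ),
      0 < ε → C → ¬ ∀ᵐ ω ∂P, ∃ p ∈ T,
        ε ≤ |∫ x, p.2 x ∂(F p.1 ω : Measure E) - ∫ x, p.2 x ∂(Q p.1 : Measure E)|) :
    HasFullWeakSupport P F Θ := by
  refine ⟨Set.Subset.antisymm (fun Q hQ c => ?_) fun Q hQ D hD => ?_, fun C₀ hC₀ =>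
    (ae_ball_iff hC₀).2 fun c _ => hconc c⟩
  · have hcl : IsClosed {R : C → ProbabilityMeasure E | (R c : Measure E) Θ = 1} :=
      (isClosed_setOf_measure_eq_one (hΘ c)).preimage
        (f := fun R : C → ProbabilityMeasure E => R c) (continuous_apply c)
    exact hQ _ ⟨hcl, hconc c⟩
  · obtain ⟨hcl, hae⟩ := hD
    by_contra hQD
    rcases isEmpty_or_nonempty C with hC | ⟨⟨c⟩⟩
    · obtain ⟨ω, hω⟩ := hae.exists
      exact hQD (Subsingleton.elim (fun c => F c ω) Q ▸ hω)
    · obtain ⟨T, ε, hε, hT⟩ := exists_finset_integral_of_notMem hcl hQD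
      refine hvisit Q hQ T ε hε c ?_
      filter_upwards [hae] with ω hω
      by_contra! h
      exact hT _ (fun p hp => h p hp) hω

namespace FDnDDP

variable {Ω : Type*} [MeasurableSpace Ω] {P : Measure Ω} {V X Loc : Type*}
  [MeasurableSpace Loc] {q : ℕ} {S : Set (Fin q → ℝ)} {α β : ℝ} {K : V → Loc → ℝ}
  {Ψ : CopulaFamily ((V × X) × Fin q)} {G : V × X → ProbabilityMeasure S}

variable (H : FDnDDP P α β K Ψ G)

lemma measurable_ofReal_clusterWeight (hKm : ∀ v, Measurable (K v)) (k : ℕ) (v : V) :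
    Measurable fun ω => ENNReal.ofReal (H.clusterWeight k v ω) :=
  ((H.measurable_clusterWeight hKm k v).mono (H.sourceSigma_le _) le_rfl).ennreal_ofReal

/-- The cluster weights are independent of the events that depend on the inner random measures. -/
lemma lintegral_clusterWeight_mul_indicator (hKm : ∀ v, Measurable (K v)) (k : ℕ) (v : V)
    {A : Set Ω}
    (hA : MeasurableSet[H.sourceSigma (⋃ k, innerSources k)] A) :
    ∫⁻ ω, ENNReal.ofReal (H.clusterWeight k v ω) * A.indicator 1 ω ∂P =
      P A * ∫⁻ ω, ENNReal.ofReal (H.clusterWeight k v ω) ∂P := by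
  have hd : Disjoint outerSources (⋃ k, innerSources k) :=
    Set.disjoint_iUnion_right.2 fun k => (disjoint_innerSources_outerSources k).symm
  rw [H.lintegral_mul_of_disjoint hd (H.measurable_clusterWeight hKm k v).ennreal_ofReal
    (measurable_indicator_one hA), lintegral_indicator_one (H.sourceSigma_le _ _ hA), mul_comm]

variable [IsProbabilityMeasure P]

/-- With positive probability, and independently of the cluster weights, the first `N` inner random
measures are all close to a prescribed family of probability measures on the support. -/
lemma exists_event_Fstar_close (hβ : 0 < β) (hΨ : ∀ J, (Ψ.copula J).HasPositiveDensity) {Θ : Set S}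
    (hΘm : MeasurableSet Θ)
    (hΘ : ∀ c, (G c : Measure S).support = Θ) {Q : V × X → ProbabilityMeasure S}
    (hQ : Q ∈ concentratedOn (V × X) Θ)
    (T : Finset ((V × X) × BoundedContinuousFunction S ℝ)) {δ : ℝ} (hδ : 0 < δ) (N : ℕ) :
    ∃ A : Set Ω, MeasurableSet[H.sourceSigma (⋃ k, innerSources k)] A ∧ 0 < P A ∧
      ∀ᵐ ω ∂P, ω ∈ A → ∀ k < N, ∀ p ∈ T,
        |∫ x, p.2 x ∂(H.Fstar k p.1 ω : Measure S) - ∫ x, p.2 x ∂(Q p.1 : Measure S)| < δ := by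
  classical
  set M : ℝ := ∑ p ∈ T, ‖p.2‖ with hM
  have hM0 : 0 ≤ M := Finset.sum_nonneg fun p _ => norm_nonneg _
  obtain ⟨n, s₁, U, s₂, W, hUo, hU, hWo, hW, happ⟩ :=
    exists_isOpen_stickBreak_approx hΘm hQ T (ε := δ / (1 + M)) (by positivity)
  set J : ℕ → Finset (V × X) := fun l => (s₂.filter fun j => j.1 = l).image Prod.snd with hJ
  have hJmem : ∀ j ∈ s₂, j.2 ∈ J j.1 := fun j hj =>
    Finset.mem_image.2 ⟨j, Finset.mem_filter.2 ⟨hj, rfl⟩, rfl⟩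
  obtain ⟨f, hfu, hfθ⟩ : ∃ f : SourceIndex → Set Ω,
      (∀ p : ℕ × ℕ, f (.inr (.inl p)) = H.u p.1 p.2 ⁻¹' U p.1) ∧
      (∀ p : ℕ × ℕ, f (.inr (.inr (.inl p))) =
        ⋂ c ∈ J p.1, H.θ p.1 p.2 c ⁻¹' W (p.1, c)) :=
    ⟨Sum.elim (fun _ => Set.univ) (Sum.elim (fun p => H.u p.1 p.2 ⁻¹' U p.1)
      (Sum.elim (fun p => ⋂ c ∈ J p.1, H.θ p.1 p.2 c ⁻¹' W (p.1, c)) fun _ => Set.univ)),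
      fun _ => rfl, fun _ => rfl⟩
  set 𝒮 : Finset SourceIndex :=
    (s₁ ×ˢ Finset.range N).image (fun p => .inr (.inl p)) ∪
      (s₂.image Prod.fst ×ˢ Finset.range N).image (fun p => .inr (.inr (.inl p))) with h𝒮
  have hcases : ∀ a ∈ 𝒮, (∃ p : ℕ × ℕ, a = .inr (.inl p)) ∨
      ∃ p : ℕ × ℕ, a = .inr (.inr (.inl p)) := by
    intro a ha
    rcases Finset.mem_union.1 ha with h | h
    · obtain ⟨p, -, rfl⟩ := Finset.mem_image.1 h; exact .inl ⟨p, rfl⟩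
    · obtain ⟨p, -, rfl⟩ := Finset.mem_image.1 h; exact .inr ⟨p, rfl⟩
  have hfm : ∀ a ∈ 𝒮, MeasurableSet[H.source a] (f a) := by
    intro a ha
    rcases hcases a ha with ⟨p, rfl⟩ | ⟨p, rfl⟩
    · rw [hfu]
      exact ⟨U p.1, (hUo _).measurableSet, rfl⟩
    · rw [hfθ]
      refine ⟨⋂ c ∈ J p.1, (fun y : V × X → S => y c) ⁻¹' W (p.1, c),
        Finset.measurableSet_biInter _ fun c _ =>
          (measurable_pi_apply c) (hWo (p.1, c)).measurableSet, ?_⟩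
      simp only [Set.preimage_iInter]
      rfl
  have hin : ∀ a ∈ 𝒮, a ∈ ⋃ k, innerSources k := by
    intro a ha
    rcases hcases a ha with ⟨p, rfl⟩ | ⟨p, rfl⟩
    · exact Set.mem_iUnion.2 ⟨p.2, p.1, .inl rfl⟩
    · exact Set.mem_iUnion.2 ⟨p.2, p.1, .inr rfl⟩
  refine ⟨⋂ a ∈ 𝒮, f a, ?_, ?_, ?_⟩
  · exact @Finset.measurableSet_biInter _ _ (H.sourceSigma _) _ 𝒮 fun a ha =>
      H.source_le_sourceSigma (hin a ha) _ (hfm a ha)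
  · rw [H.iIndep_source.meas_biInter hfm, pos_iff_ne_zero, Finset.prod_ne_zero_iff]
    intro a ha
    rcases hcases a ha with ⟨p, rfl⟩ | ⟨p, rfl⟩
    · obtain ⟨x, hxU, hx⟩ := hU p.1
      rw [hfu, ← Measure.map_apply (H.measurable_u p.1 p.2) (hUo _).measurableSet, H.law_u]
      exact (betaMeasure_pos one_pos hβ (hUo _) hxU hx).ne'
    · have := H.measure_θ_mem_pos hΨ p.1 p.2 (J p.1) (U := fun c => W (p.1, c))
        (fun c _ => hWo _) (fun c _ => by rw [hΘ c]; exact hW _)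
      rw [hfθ]
      convert this.ne' using 2
      ext ω
      simp
  · have hall : ∀ᵐ ω ∂P, ∀ k, ∀ p : T, (H.Fstar k p.1.1 ω : Measure S) =
        Measure.sum fun l => H.atomWeight l k ω • Measure.dirac (H.θ l k p.1.1 ω) :=
      ae_all_iff.2 fun k => ae_all_iff.2 fun p => H.Fstar_ae_eq_sum k p.1.1
    filter_upwards [hall] with ω hω hA k hk p hp
    have hAmem : ∀ a ∈ 𝒮, ω ∈ f a := fun a ha => Set.mem_iInter₂.1 hA a ha
    obtain ⟨h1, h2⟩ := happ (fun i => H.u i k ω) (fun j => H.θ j.1 k j.2 ω)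
      (fun i hi => by
        have := hAmem (.inr (.inl (i, k))) (Finset.mem_union_left _ (Finset.mem_image.2
          ⟨(i, k), Finset.mem_product.2 ⟨hi, Finset.mem_range.2 hk⟩, rfl⟩))
        rwa [hfu] at this)
      (fun j hj => by
        have := hAmem (.inr (.inr (.inl (j.1, k)))) (Finset.mem_union_right _ (Finset.mem_image.2
          ⟨(j.1, k), Finset.mem_product.2 ⟨Finset.mem_image_of_mem _ hj,
            Finset.mem_range.2 hk⟩, rfl⟩))
        rw [hfθ] at this
        exact Set.mem_iInter₂.1 this j.2 (hJmem j hj))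
    have h3 := abs_integral_sub_sum_le (ν := fun l => Measure.dirac (H.θ l k p.1 ω))
      (stickBreak_nonneg fun i => H.u_mem i k ω) (hω k ⟨p, hp⟩) (f := p.2) (M := ‖p.2‖)
      p.2.continuous.measurable (fun x => p.2.norm_coe_le_norm x) n
    rw [one_sub_sum_stickBreak] at h3
    simp only [integral_dirac] at h3
    have h4 := h2 p hp
    have hpM : ‖p.2‖ ≤ M := Finset.single_le_sum (f := fun p => ‖p.2‖)
      (fun p _ => norm_nonneg _) hp
    have h5 : ‖p.2‖ * ∏ i ∈ Finset.range n, (1 - H.u i k ω) ≤ M * (δ / (1 + M)) :=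
      mul_le_mul hpM h1.le (Finset.prod_nonneg fun i _ => sub_nonneg.2 (H.u_mem i k ω).2) hM0
    have h6 : M * (δ / (1 + M)) + δ / (1 + M) = δ := by field_simp; ring
    calc _ ≤ _ := abs_sub_le _ (∑ l ∈ Finset.range n, stickBreak (fun i => H.u i k ω) l *
          p.2 (H.θ l k p.1 ω)) _
      _ < M * (δ / (1 + M)) + δ / (1 + M) := add_lt_add_of_le_of_lt (h3.trans h5) h4
      _ = δ := h6

/-- The expected weight of the classes from `N` on tends to zero. -/
lemma exists_tsum_lintegral_clusterWeight_lt (hKm : ∀ v, Measurable (K v)) (J : Finset (V × X))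
    {η : ℝ≥0∞} (hη : 0 < η) :
    ∃ N : ℕ, ∑ c ∈ J, ∑' k, ∫⁻ ω, ENNReal.ofReal (H.clusterWeight (k + N) c.1 ω) ∂P < η := by
  have h : Tendsto (fun N => ∑ c ∈ J, ∑' k, ∫⁻ ω, ENNReal.ofReal (H.clusterWeight (k + N) c.1 ω) ∂P)
      atTop (𝓝 (∑ c ∈ J, 0)) := by
    refine tendsto_finsetSum _ fun c _ => ENNReal.tendsto_sum_nat_add
      (fun k => ∫⁻ ω, ENNReal.ofReal (H.clusterWeight k c.1 ω) ∂P) ?_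
    rw [← lintegral_tsum fun k => (H.measurable_ofReal_clusterWeight hKm k c.1).aemeasurable,
      lintegral_congr_ae (H.tsum_clusterWeight c)]
    simp
  rw [Finset.sum_const_zero] at h
  exact (h.eventually_lt_const hη).exists

/-- The mean of `F*_k(c)` is `G c`, which does not charge the complement of its support. -/
lemma ae_Fstar_compl_eq_zero {Θ : Set S} (hΘm : MeasurableSet Θ)
    (hΘ : ∀ c, (G c : Measure S).support = Θ) (c : V × X) :
    ∀ᵐ ω ∂P, ∀ k, (H.Fstar k c ω : Measure S) Θᶜ = 0 := by
  refine ae_all_iff.2 fun k => ?_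
  have h := H.lintegral_innerMass k c hΘm.compl
  rw [← hΘ c, Measure.measure_compl_support, hΘ c, lintegral_eq_zero_iff
    ((H.measurable_innerMass k c hΘm.compl).mono (H.sourceSigma_le _) le_rfl)] at h
  filter_upwards [h, H.Fstar_ae_eq_innerMass k c hΘm.compl] with ω h1 h2
  rw [h2, h1, Pi.zero_apply]

/-- On the event that the first inner measures are close to `Q`, the mixture is close to `Q` as soon
as the remaining weights are small. Their mean on this event is too small for them to be almost
surely large. -/
theorem hasFullWeakSupport_F (hβ : 0 < β) (hKm : ∀ v, Measurable (K v))
    (hK : ∀ v g, K v g ∈ Set.Ioc (0 : ℝ) 1)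
    (hΨ : ∀ J, (Ψ.copula J).HasPositiveDensity) {Θ : Set S}
    (hΘ : ∀ c, (G c : Measure S).support = Θ) : HasFullWeakSupport P H.F Θ := by
  classical
  have hcl : V × X → IsClosed Θ := fun c => hΘ c ▸ Measure.isClosed_support
  refine hasFullWeakSupport_of_forall hcl (fun c => ?_) fun Q hQ T ε hε c hae => ?_
  · have hΘm := (hcl c).measurableSet
    filter_upwards [H.F_eq c Θᶜ hΘm.compl, H.ae_Fstar_compl_eq_zero hΘm hΘ c] with ω h1 h2
    rw [← prob_compl_eq_zero_iff hΘm, h1]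
    simp [h2]
  have hΘm := (hcl c).measurableSet
  set M : ℝ := ∑ p ∈ T, ‖p.2‖ with hM
  have hM0 : 0 ≤ M := Finset.sum_nonneg fun p _ => norm_nonneg _
  set η : ℝ := ε / (4 * (1 + M)) with hη
  have hη0 : 0 < η := by positivity
  set J : Finset (V × X) := T.image Prod.fst with hJ
  obtain ⟨N, hN⟩ := H.exists_tsum_lintegral_clusterWeight_lt hKm J (ENNReal.ofReal_pos.2 hη0)
  obtain ⟨A, hAm, hApos, hA⟩ :=
    H.exists_event_Fstar_close hβ hΨ hΘm hΘ hQ T (half_pos hε) N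
  set t : Ω → ℝ≥0∞ := fun ω => ∑ c ∈ J, ∑' k, ENNReal.ofReal (H.clusterWeight (k + N) c.1 ω) with ht
  have htm : Measurable t := Finset.measurable_sum _ fun c _ => measurable_tsum_ennreal fun k =>
    H.measurable_ofReal_clusterWeight hKm (k + N) c.1
  -- the mean of the remaining cluster weights on `A` is less than `η`
  have htA : ∫⁻ ω, t ω * A.indicator 1 ω ∂P < P A * ENNReal.ofReal η := by
    have e : ∫⁻ ω, t ω * A.indicator 1 ω ∂P =
        P A * ∑ c ∈ J, ∑' k, ∫⁻ ω, ENNReal.ofReal (H.clusterWeight (k + N) c.1 ω) ∂P := by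
      have hAi : Measurable (A.indicator (1 : Ω → ℝ≥0∞)) :=
        measurable_indicator_one (H.sourceSigma_le _ _ hAm)
      simp_rw [ht, Finset.sum_mul, ← ENNReal.tsum_mul_right]
      rw [lintegral_finsetSum _ fun c _ => measurable_tsum_ennreal fun k =>
        (H.measurable_ofReal_clusterWeight hKm (k + N) c.1).fun_mul hAi, Finset.mul_sum]
      refine Finset.sum_congr rfl fun c _ => ?_
      rw [lintegral_tsum fun k => ((H.measurable_ofReal_clusterWeight hKm (k + N) c.1).fun_mul
        hAi).aemeasurable, ← ENNReal.tsum_mul_left]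
      exact tsum_congr fun k => H.lintegral_clusterWeight_mul_indicator hKm (k + N) c.1 hAm
    rw [e]
    exact ENNReal.mul_lt_mul_right hApos.ne' (measure_ne_top _ _) hN
  have hsum1 : ∀ᵐ ω ∂P, ∀ p : T, ∑' k, ENNReal.ofReal (H.clusterWeight k p.1.1.1 ω) = 1 :=
    ae_all_iff.2 fun p => H.tsum_clusterWeight p.1.1
  have hFsum : ∀ᵐ ω ∂P, ∀ p : T, (H.F p.1.1 ω : Measure S) =
      Measure.sum fun k => ENNReal.ofReal (H.clusterWeight k p.1.1.1 ω) •
        (H.Fstar k p.1.1 ω : Measure S) :=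
    ae_all_iff.2 fun p => H.F_ae_eq_sum p.1.1
  -- hence these weights are not almost surely at least `η` on `A`
  have hge : ∀ᵐ ω ∂P, A.indicator 1 ω * ENNReal.ofReal η ≤ t ω * A.indicator 1 ω := by
    filter_upwards [hae, hA, hsum1, hFsum] with ω hω hAω h1 hF
    by_cases hωA : ω ∈ A
    swap
    · simp [hωA]
    simp only [Set.indicator_of_mem hωA, Pi.one_apply, one_mul, mul_one]
    by_contra! hlt
    obtain ⟨p, hp, hge⟩ := hω
    refine hge.not_gt ?_
    set w : ℕ → ℝ := fun k => H.clusterWeight k p.1.1 ω with hw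
    have hw0 : ∀ k, 0 ≤ w k := fun k => (H.clusterWeight_mem hK k p.1.1 ω).1
    have htail : 1 - ∑ k ∈ Finset.range N, w k < η := by
      have h2 := ENNReal.summable.sum_add_tsum_nat_add'
        (f := fun k => ENNReal.ofReal (w k)) (k := N)
      rw [show ∑' k, ENNReal.ofReal (w k) = 1 from h1 ⟨p, hp⟩,
        ← ENNReal.ofReal_sum_of_nonneg fun k _ => hw0 k] at h2
      have h3 : ∑' k, ENNReal.ofReal (w (k + N)) < ENNReal.ofReal η :=
        lt_of_le_of_lt (Finset.single_le_sum (f := fun c : V × X => ∑' k, ENNReal.ofReal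
          (H.clusterWeight (k + N) c.1 ω)) (fun _ _ => zero_le) (Finset.mem_image_of_mem _ hp)) hlt
      by_contra! hle
      have h4 : (1 : ℝ≥0∞) < 1 := by
        calc (1 : ℝ≥0∞) = _ := h2.symm
          _ < ENNReal.ofReal (∑ k ∈ Finset.range N, w k) + ENNReal.ofReal η :=
            ENNReal.add_lt_add_left ENNReal.ofReal_ne_top h3
          _ = ENNReal.ofReal (∑ k ∈ Finset.range N, w k + η) :=
            (ENNReal.ofReal_add (Finset.sum_nonneg fun k _ => hw0 k) hη0.le).symm
          _ ≤ ENNReal.ofReal 1 := ENNReal.ofReal_le_ofReal (by linarith)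
          _ = 1 := ENNReal.ofReal_one
      exact lt_irrefl _ h4
    have hclose := fun k hk => hAω hωA k hk p hp
    have h3 := abs_integral_sub_sum_le (ν := fun k => (H.Fstar k p.1 ω : Measure S)) hw0
      (hF ⟨p, hp⟩) (f := p.2) (M := ‖p.2‖) p.2.continuous.measurable
      (fun x => p.2.norm_coe_le_norm x) N
    set y : ℝ := ∫ x, p.2 x ∂(Q p.1 : Measure S) with hy
    have hyM : |y| ≤ ‖p.2‖ := by
      have := norm_integral_le_of_norm_le_const (μ := (Q p.1 : Measure S)) (f := p.2) (C := ‖p.2‖)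
        (ae_of_all _ fun x => p.2.norm_coe_le_norm x)
      simpa using this
    have hpM : ‖p.2‖ ≤ M := Finset.single_le_sum (f := fun p => ‖p.2‖)
      (fun p _ => norm_nonneg _) hp
    have htail0 : 0 ≤ 1 - ∑ k ∈ Finset.range N, w k := by
      rw [hw]
      simp only [clusterWeight]
      rw [one_sub_sum_stickBreak]
      exact Finset.prod_nonneg fun i _ => sub_nonneg.2 (mul_le_one₀ (hK _ _).2 (H.s_mem i ω).1
        (H.s_mem i ω).2)
    have h4 : |∑ k ∈ Finset.range N, w k * ∫ x, p.2 x ∂(H.Fstar k p.1 ω : Measure S) - y| ≤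
        ε / 2 + ‖p.2‖ * (1 - ∑ k ∈ Finset.range N, w k) := by
      have e : ∑ k ∈ Finset.range N, w k * ∫ x, p.2 x ∂(H.Fstar k p.1 ω : Measure S) - y =
          ∑ k ∈ Finset.range N, w k * (∫ x, p.2 x ∂(H.Fstar k p.1 ω : Measure S) - y) -
            y * (1 - ∑ k ∈ Finset.range N, w k) := by
        simp_rw [mul_sub]
        rw [Finset.sum_sub_distrib, ← Finset.sum_mul]
        ring
      rw [e]
      refine (abs_sub _ _).trans (add_le_add ?_ ?_)
      · calc _ ≤ ∑ k ∈ Finset.range N, w k * (ε / 2) := by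
              refine (Finset.abs_sum_le_sum_abs _ _).trans (Finset.sum_le_sum fun k hk => ?_)
              rw [abs_mul, abs_of_nonneg (hw0 k)]
              exact mul_le_mul_of_nonneg_left (hclose k (Finset.mem_range.1 hk)).le (hw0 k)
          _ = (∑ k ∈ Finset.range N, w k) * (ε / 2) := (Finset.sum_mul _ _ _).symm
          _ ≤ 1 * (ε / 2) := by gcongr; linarith
          _ = ε / 2 := one_mul _
      · rw [abs_mul, abs_of_nonneg htail0]
        gcongr
    have h5 : ‖p.2‖ * (1 - ∑ k ∈ Finset.range N, w k) ≤ M * η :=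
      mul_le_mul hpM htail.le htail0 hM0
    have h6 : M * η + M * η < ε / 2 := by
      have : M * η + M * η + 2 * η = ε / 2 := by rw [hη]; field_simp; ring
      linarith
    have h7 := abs_sub_le (∫ x, p.2 x ∂(H.F p.1 ω : Measure S))
      (∑ k ∈ Finset.range N, w k * ∫ x, p.2 x ∂(H.Fstar k p.1 ω : Measure S)) y
    linarith
  have hfin := lintegral_mono_ae hge
  rw [lintegral_mul_const _ (measurable_indicator_one (H.sourceSigma_le _ _ hAm)),
    lintegral_indicator_one (H.sourceSigma_le _ _ hAm)] at hfin
  exact hfin.not_gt htA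

/-- On the event that the first inner measures are close to `Q`, so is the random measure of a
cluster, unless its class is large for one of the finitely many covariates. -/
theorem Allocation.hasFullWeakSupport_clusterF {H : FDnDDP P α β K Ψ G} {n : ℕ}
    (Z : H.Allocation n) (hβ : 0 < β) (hKm : ∀ v, Measurable (K v))
    (hK : ∀ v g, K v g ∈ Set.Ioc (0 : ℝ) 1)
    (hΨ : ∀ J, (Ψ.copula J).HasPositiveDensity) {Θ : Set S}
    (hΘ : ∀ c, (G c : Measure S).support = Θ) (i : Fin n) :
    HasFullWeakSupport P (Z.clusterF i) Θ := by
  classical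
  have hcl : V × X → IsClosed Θ := fun c => hΘ c ▸ Measure.isClosed_support
  refine hasFullWeakSupport_of_forall hcl (fun c => ?_) fun Q hQ T ε hε c hae => ?_
  · have hΘm := (hcl c).measurableSet
    filter_upwards [H.ae_Fstar_compl_eq_zero hΘm hΘ c] with ω h2
    rw [← prob_compl_eq_zero_iff hΘm]
    exact h2 _
  have hΘm := (hcl c).measurableSet
  set J : Finset (V × X) := T.image Prod.fst with hJ
  obtain ⟨N, hN⟩ := H.exists_tsum_lintegral_clusterWeight_lt hKm J one_pos
  obtain ⟨A, hAm, hApos, hA⟩ := H.exists_event_Fstar_close hβ hΨ hΘm hΘ hQ T hε N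
  -- almost surely on `A`, one of the classes is at least `N`, which is too unlikely
  have hsub : ∀ᵐ ω ∂P, ω ∈ A → ω ∈ ⋃ c ∈ J, ⋃ k, {ω | Z.ζ i c.1 ω = k + N} ∩ A := by
    filter_upwards [hae, hA] with ω hω hAω hωA
    obtain ⟨p, hp, hge⟩ := hω
    have hNle : N ≤ Z.ζ i p.1.1 ω := by
      by_contra! hlt
      exact hge.not_gt (hAω hωA _ hlt p hp)
    refine Set.mem_iUnion₂.2 ⟨p.1, Finset.mem_image_of_mem _ hp, Set.mem_iUnion.2
      ⟨Z.ζ i p.1.1 ω - N, ?_, hωA⟩⟩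
    show Z.ζ i p.1.1 ω = Z.ζ i p.1.1 ω - N + N
    omega
  have hterm : ∀ (c : V × X) (k : ℕ), P ({ω | Z.ζ i c.1 ω = k + N} ∩ A) =
      P A * ∫⁻ ω, ENNReal.ofReal (H.clusterWeight (k + N) c.1 ω) ∂P := by
    intro c k
    rw [← H.lintegral_clusterWeight_mul_indicator hKm (k + N) c.1 hAm]
    have h := Z.setLIntegral_eq hKm hK {i} (fun _ => c.1) (fun _ => k + N)
      (g := A.indicator 1) ((measurable_indicator_one hAm).mono
        (H.sourceSigma_le_sigma _) le_rfl)
    simp only [Finset.mem_singleton, forall_eq, Finset.prod_singleton] at h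
    rw [← h, lintegral_indicator_one (H.sourceSigma_le _ _ hAm),
      Measure.restrict_apply (H.sourceSigma_le _ _ hAm), Set.inter_comm]
  have hlt : P A < P A := by
    calc P A ≤ P (⋃ c ∈ J, ⋃ k, {ω | Z.ζ i c.1 ω = k + N} ∩ A) := measure_mono_ae hsub
      _ ≤ ∑ c ∈ J, P (⋃ k, {ω | Z.ζ i c.1 ω = k + N} ∩ A) := measure_biUnion_finset_le _ _
      _ ≤ ∑ c ∈ J, ∑' k, P ({ω | Z.ζ i c.1 ω = k + N} ∩ A) :=
        Finset.sum_le_sum fun c _ => measure_iUnion_le _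
      _ = P A * ∑ c ∈ J, ∑' k, ∫⁻ ω, ENNReal.ofReal (H.clusterWeight (k + N) c.1 ω) ∂P := by
        rw [Finset.mul_sum]
        refine Finset.sum_congr rfl fun c _ => ?_
        rw [← ENNReal.tsum_mul_left]
        exact tsum_congr fun k => hterm c k
      _ < P A * 1 := ENNReal.mul_lt_mul_right hApos.ne' (measure_ne_top _ _) hN
      _ = P A := mul_one _
  exact lt_irrefl _ hlt

end FDnDDP

/-! ### The moments and the weak support of the process -/

theorem mainTheorem5 {Ω : Type*} [MeasurableSpace Ω] (P : Measure Ω) [IsProbabilityMeasure P]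
    {V X Loc : Type*} [MeasurableSpace Loc] {q : ℕ} {S : Set (Fin q → ℝ)}
    (α β : ℝ) (hα : 0 < α) (hβ : 0 < β)
    (K : V → Loc → ℝ) (hK_meas : ∀ v, Measurable (K v)) (hK : ∀ v g, K v g ∈ Set.Ioc (0 : ℝ) 1)
    (Ψ : CopulaFamily ((V × X) × Fin q)) (G : V × X → ProbabilityMeasure S)
    (H : FDnDDP P α β K Ψ G) (n : ℕ) (Z : H.Allocation n) :
    -- mean and variance
    (∀ (i : Fin n) (c : V × X) (A : Set S), MeasurableSet A →
      MemLp (fun ω => (Z.clusterF i c ω : Measure S).real A) 2 P ∧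
      ∫ ω, (Z.clusterF i c ω : Measure S).real A ∂P = (G c : Measure S).real A ∧
      Var[fun ω => (Z.clusterF i c ω : Measure S).real A; P] =
        (G c : Measure S).real A * (1 - (G c : Measure S).real A) / (β + 1)) ∧
    -- correlation within a cluster, whose cluster-level covariate is `v`
    (∀ (i : Fin n) (v : V) (x x' : X) (A B : Set S), MeasurableSet A → MeasurableSet B →
      (G (v, x) : Measure S).real A ∈ Set.Ioo (0 : ℝ) 1 →
      (G (v, x') : Measure S).real B ∈ Set.Ioo (0 : ℝ) 1 → ∀ l k : ℕ,
      corr (fun ω => (Z.clusterF i (v, x) ω : Measure S).real A)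
          (fun ω => (Z.clusterF i (v, x') ω : Measure S).real B) P =
        corrRatio (P.real {ω | H.θ l k (v, x) ω ∈ A ∧ H.θ l k (v, x') ω ∈ B})
          ((G (v, x) : Measure S).real A) ((G (v, x') : Measure S).real B)) ∧
    -- the series defining `h` converges
    (∀ (v v' : V) (γ : ℕ → Loc), Summable (hTerm α K v v' γ)) ∧
    -- correlation between two different clusters
    (∀ i j : Fin n, i ≠ j → ∀ (v v' : V) (x x' : X) (A B : Set S),
      MeasurableSet A → MeasurableSet B →
      (G (v, x) : Measure S).real A ∈ Set.Ioo (0 : ℝ) 1 →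
      (G (v', x') : Measure S).real B ∈ Set.Ioo (0 : ℝ) 1 → ∀ l k : ℕ,
      corr (fun ω => (Z.clusterF i (v, x) ω : Measure S).real A)
          (fun ω => (Z.clusterF j (v', x') ω : Measure S).real B) P =
        (∫ ω, hFactor α K v v' (fun m => H.Γ m ω) ∂P) *
          corrRatio (P.real {ω | H.θ l k (v, x) ω ∈ A ∧ H.θ l k (v', x') ω ∈ B})
            ((G (v, x) : Measure S).real A) ((G (v', x') : Measure S).real B) ∧
      -- in particular, for deterministic locations `γ`
      ∀ γ : ℕ → Loc, (∀ᵐ ω ∂P, ∀ m, H.Γ m ω = γ m) →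
        corr (fun ω => (Z.clusterF i (v, x) ω : Measure S).real A)
            (fun ω => (Z.clusterF j (v', x') ω : Measure S).real B) P =
          hFactor α K v v' γ *
            corrRatio (P.real {ω | H.θ l k (v, x) ω ∈ A ∧ H.θ l k (v', x') ω ∈ B})
              ((G (v, x) : Measure S).real A) ((G (v', x') : Measure S).real B)) ∧
    -- full weak support
    ((∀ J, (Ψ.copula J).HasPositiveDensity) → ∀ Θ : Set S,
      (∀ c, (G c : Measure S).support = Θ) →
      HasFullWeakSupport P H.F Θ ∧ ∀ i : Fin n, HasFullWeakSupport P (Z.clusterF i) Θ) := by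
  refine ⟨fun i c A hA => ⟨Z.memLp_clusterF i c hA, Z.integral_clusterF hK_meas hK i c hA,
      Z.variance_clusterF hβ hK_meas hK i c hA⟩,
    fun i v x x' A B hA hB _ _ l k => Z.corr_clusterF_self hβ hK_meas hK i v x x' hA hB l k,
    fun v v' γ => summable_hTerm hα hK v v' γ,
    fun i j hij v v' x x' A B hA hB _ _ l k =>
      ⟨Z.corr_clusterF_of_ne hα hβ hK_meas hK hij (v, x) (v', x') hA hB l k, fun γ hγ => ?_⟩,
    fun hΨ Θ hΘ => ⟨H.hasFullWeakSupport_F hβ hK_meas hK hΨ hΘ,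
      fun i => Z.hasFullWeakSupport_clusterF hβ hK_meas hK hΨ hΘ i⟩⟩
  have hconst : ∫ ω, hFactor α K v v' (fun m => H.Γ m ω) ∂P = hFactor α K v v' γ := by
    rw [integral_congr_ae (g := fun _ => hFactor α K v v' γ)
      (hγ.mono fun ω hω => congrArg (hFactor α K v v') (funext hω))]
    simp
  rw [← hconst]
  exact Z.corr_clusterF_of_ne hα hβ hK_meas hK hij (v, x) (v', x') hA hB l k
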